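/- **Theorem 4.4.** Let $(X,Y)$ be a dual pair of real locally convex spaces: $\langle\cdot,\cdot\rangle$ is a bilinear form on $X\times Y$ separating the points of $X$ and of $Y$, and the topologies of $X$ and $Y$ are locally convex vector topologies compatible with it (the continuous linear functionals on $X$ are exactly the maps $\langle\cdot,x^*\rangle$, $x^*\in Y$, and those on $Y$ are exactly the maps $\langle x,\cdot\rangle$, $x\in X$). Let $\Phi:X\to\mathbb R\cup\{+\infty\}$ have nonempty domain $\operatorname{dom}\Phi=\{\Phi<+\infty\}$ and a convex and closed epigraph. Write $\Phi^*(x^*)=\sup_{x\in X}(\langle x,x^*\rangle-\Phi(x))$ for its conjugate and $\partial\Phi(x)$ for its subdifferential, that is, $\partial\Phi(x)=\{x^*\in Y:\langle u-x,x^*\rangle\le\Phi(u)-\Phi(x)\ \ \forall u\in X\}$ if $x\in\operatorname{dom}\Phi$ and $\partial\Phi(x)=\emptyset$ otherwise. For a set $S$, let $\operatorname{ri}S$ be the interior of $S$ relative to its affine hull $\operatorname{aff}S$ if $\operatorname{aff}S$ is closed, and $\operatorname{ri}S=\emptyset$ otherwise. Assume that at least one of the following holds: * $\operatorname{ri}(\operatorname{dom}\Phi)\neq\emptyset$,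 and the restriction of $\Phi$ to $\operatorname{aff}(\operatorname{dom}\Phi)$ is finite and continuous at every point of $\operatorname{ri}(\operatorname{dom}\Phi)$; * with respect to the Mackey topology $\tau(Y,X)$ on $Y$ (uniform convergence on the absolutely convex $\sigma(X,Y)$-compact subsets of $X$), $\operatorname{ri}(\operatorname{dom}\Phi^*)\neq\emptyset$, and the restriction of $\Phi^*$ to $\operatorname{aff}(\operatorname{dom}\Phi^*)$ is finite and continuous at every point of $\operatorname{ri}(\operatorname{dom}\Phi^*)$. Then for every $\bar x\in\operatorname{dom}\Phi$, the normal cone $\mathrm N_{[\Phi\le\Phi(\bar x)]}(\bar x)=\{x^*\in Y:\langle x-\bar x,x^*\rangle\le0 \text{ for all } x \text{ with } \Phi(x)\le\Phi(\bar x)\}$ satisfies $$\mathrm N_{[\Phi\le\Phi(\bar x)]}(\bar x)=\limsup_{\substack{x\to_{\operatorname{dom}\Phi^*}\bar x,\ \mu\ge0\\ \mu(\Phi(x)-\Phi(\bar x))\to0\\ \mu\langle\cdot,x-\bar x\rangle\to0}}\mu\,\partial\Phi(x)=\limsup_{\substack{\mu\ge0\\ \mu(\Phi(x)-\Phi(\bar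 x))\to0\\ \mu\langle\cdot,x-\bar x\rangle\to0}}\mu\,\partial\Phi(x).$$ Here the last upper limit is the set of all limits in $Y$ of convergent nets $(\mu_ix_i^*)_i$ with $\mu_i\ge0$, $x_i\in X$, $x_i^*\in\partial\Phi(x_i)$, $\mu_i(\Phi(x_i)-\Phi(\bar x))\to0$ and $\mu_i\langle x_i-\bar x,x_i^*\rangle\to0$; in the first upper limit one requires in addition that $x_i\to_{\operatorname{dom}\Phi^*}\bar x$, which means that the class of $x_i$ converges to the class of $\bar x$ in the topological quotient space $X/(\operatorname{dom}\Phi^*)^\perp$, where $(\operatorname{dom}\Phi^*)^\perp=\{x\in X:\langle x,x^*\rangle=0\ \ \forall x^*\in\operatorname{dom}\Phi^*\}$. -/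

import Mathlib

open Filter Topology

noncomputable section

namespace ConvexDual

/-- `(X, Y)` is a dual pair of locally convex spaces for the bilinear form `B`: `B` separates the
points of `X` and of `Y`, and the given topologies of `X` and `Y` are compatible with the pairing,
i.e. the continuous linear functionals on `X` are exactly the maps `B · y`, and those on `Y` are
exactly the maps `B x ·`. -/
structure IsDualPair {X Y : Type*} [AddCommGroup X] [Module ℝ X] [TopologicalSpace X]
    [AddCommGroup Y] [Module ℝ Y] [TopologicalSpace Y] (B : X →ₗ[ℝ] Y →ₗ[ℝ] ℝ) : Prop where
  separatingLeft : B.SeparatingLeft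
  separatingRight : B.SeparatingRight
  continuous_left_iff : ∀ f : X →ₗ[ℝ] ℝ, Continuous f ↔ ∃ y : Y, f = B.flip y
  continuous_right_iff : ∀ g : Y →ₗ[ℝ] ℝ, Continuous g ↔ ∃ x : X, g = B x

section Functions

variable {E : Type*}

/-- Effective domain of an extended real valued function. -/
def dom (f : E → EReal) : Set E := {x | f x < ⊤}

/-- Epigraph, as a subset of `E × ℝ`. -/
def epi (f : E → EReal) : Set (E × ℝ) := {p | f p.1 ≤ (p.2 : EReal)}

/-- `f ∈ Γ₀(E)`: `f` takes values in `ℝ ∪ {+∞}`, has nonempty domain, and its epigraph is convex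
and closed. -/
structure IsGammaZero [AddCommGroup E] [Module ℝ E] [TopologicalSpace E] (f : E → EReal) :
    Prop where
  ne_bot : ∀ x, f x ≠ ⊥
  dom_nonempty : (dom f).Nonempty
  convex_epi : Convex ℝ (epi f)
  isClosed_epi : IsClosed (epi f)

/-- Sublevel set `[f ≤ c]`. -/
def sublevel (f : E → EReal) (c : EReal) : Set E := {x | f x ≤ c}

open Classical in
/-- Relative interior of `S` for the topology `t`: the interior of `S` relative to its affine hull
if this hull is closed, and the empty set otherwise. -/
def relInterior [AddCommGroup E] [Module ℝ E] (t : TopologicalSpace E) (S : Set E) : Set E :=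
  if IsClosed[t] (affineSpan ℝ S : Set E) then intrinsicInterior ℝ S else ∅

/-- With respect to the topology `t`, `ri (dom f)` is nonempty and the restriction of `f` to the
affine hull of `dom f` is finite and continuous at every point of `ri (dom f)`. -/
def FiniteContinuousOnRelInterior [AddCommGroup E] [Module ℝ E] (t : TopologicalSpace E)
    (f : E → EReal) : Prop :=
  (relInterior t (dom f)).Nonempty ∧
    ∀ x ∈ relInterior t (dom f), f x ≠ ⊥ ∧ f x ≠ ⊤ ∧
      ContinuousWithinAt f (affineSpan ℝ (dom f) : Set E) x

/-- Painlevé–Kuratowski upper limit of the multifunction `M` along the filter `F` of the source: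
every neighbourhood of `v` meets `M u` for some `u` in each member of `F`. -/
def upperLimit {U V : Type*} [TopologicalSpace V] (F : Filter U) (M : U → Set V) : Set V :=
  {v | ∀ W ∈ 𝓝 v, ∀ Z ∈ F, ∃ u ∈ Z, (M u ∩ W).Nonempty}

end Functions

section Pairing

variable {X Y : Type*} [AddCommGroup X] [Module ℝ X] [AddCommGroup Y] [Module ℝ Y]

/-- The weak topology `σ(X, Y)`. -/
abbrev weakTopology (B : X →ₗ[ℝ] Y →ₗ[ℝ] ℝ) : TopologicalSpace X :=
  TopologicalSpace.induced (fun x : X => fun y : Y => B x y) inferInstance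

/-- The Mackey topology `τ(Y, X)` on `Y`: uniform convergence on the absolutely convex
`σ(X, Y)`-compact subsets of `X`. -/
abbrev mackeyTopology (B : X →ₗ[ℝ] Y →ₗ[ℝ] ℝ) : TopologicalSpace Y :=
  TopologicalSpace.induced
    (fun y : Y => UniformOnFun.ofFun
      {K : Set X | Convex ℝ K ∧ Balanced ℝ K ∧ @IsCompact X (weakTopology B) K}
      (fun x : X => B x y))
    inferInstance

/-- Fenchel conjugate. -/
def conj (B : X →ₗ[ℝ] Y →ₗ[ℝ] ℝ) (f : X → EReal) (y : Y) : EReal :=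
  ⨆ x : X, (((B x y : ℝ) : EReal) - f x)

/-- Normal cone to `S` at `x₀`. -/
def normalCone (B : X →ₗ[ℝ] Y →ₗ[ℝ] ℝ) (S : Set X) (x₀ : X) : Set Y :=
  {y | ∀ x ∈ S, B (x - x₀) y ≤ 0}

/-- Subdifferential of `f` at `x`; it is empty when `x` is outside `dom f`. -/
def subdiff (B : X →ₗ[ℝ] Y →ₗ[ℝ] ℝ) (f : X → EReal) (x : X) : Set Y :=
  {y | x ∈ dom f ∧ ∀ u : X, ((B (u - x) y : ℝ) : EReal) ≤ f u - f x}

/-- The orthogonal space `A^⊥ ⊆ X` of a set `A ⊆ Y`. -/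
def orth (B : X →ₗ[ℝ] Y →ₗ[ℝ] ℝ) (A : Set Y) : Submodule ℝ X where
  carrier := {x | ∀ y ∈ A, B x y = 0}
  add_mem' := by
    intro a b ha hb y hy
    simp [ha y hy, hb y hy]
  zero_mem' := by
    intro y _
    simp
  smul_mem' := by
    intro c x hx y hy
    simp [hx y hy]

/-- The multifunction `μ ∂f(x)`, indexed by triples `(x, μ, x*)`: its value is `{μ x*}` if
`x* ∈ ∂f(x)`, and empty otherwise. -/
def scaledSubdiff (B : X →ₗ[ℝ] Y →ₗ[ℝ] ℝ) (f : X → EReal) (p : X × ℝ × Y) : Set Y :=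
  {y | p.2.2 ∈ subdiff B f p.1 ∧ y = p.2.1 • p.2.2}

/-- The filter on triples `(x, μ, x*)` expressing `μ ≥ 0`, `μ (f x - f x₀) → 0` and
`μ ⟨x*, x - x₀⟩ → 0`. It is used only at triples with `x* ∈ ∂f(x)`, where `f x` is a real number. -/
def valueFilter (B : X →ₗ[ℝ] Y →ₗ[ℝ] ℝ) (f : X → EReal) (x₀ : X) : Filter (X × ℝ × Y) :=
  𝓟 {p | 0 ≤ p.2.1} ⊓
    comap (fun p => p.2.1 * ((f p.1).toReal - (f x₀).toReal)) (𝓝 0) ⊓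
    comap (fun p => p.2.1 * B (p.1 - x₀) p.2.2) (𝓝 0)

/-- The filter on triples `(x, μ, x*)` expressing `x →_A x₀`: the class of `x` converges to the
class of `x₀` in the topological quotient `X / A^⊥`. -/
def quotientFilter [TopologicalSpace X] (B : X →ₗ[ℝ] Y →ₗ[ℝ] ℝ) (A : Set Y) (x₀ : X) :
    Filter (X × ℝ × Y) :=
  comap (fun p => (Submodule.Quotient.mk p.1 : X ⧸ orth B A))
    (𝓝 (Submodule.Quotient.mk x₀ : X ⧸ orth B A))

end Pairing

end ConvexDual

end

open ConvexDual

noncomputable section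

namespace ConvexDual

open scoped Pointwise

/-! The three sets are compared cyclically. The restricted upper limit lies in the unrestricted one,
and `upperLimit_subset_normalCone` puts the latter in the normal cone by multiplying the subgradient
inequality by `μ` and passing to the limit. The substance is that every normal vector `v` is a limit
of scaled exact subgradients.

Approximate subgradients come from duality (`exists_approx_of_mem_normalCone`). The pairs `(μ • y, μ
* ε)`, with `y` an `ε`-subgradient at `x₀` and `μ > 0`, form a convex cone. A functional separating
`(v, 0)` from its closure would give, by Fenchel-Moreau, a direction along which `f` does not rise
above `f x₀` and on which `v` is positive, contrary to normality.

Exact subgradients then come from a Brøndsted-Rockafellar argument without completeness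
(`exists_subdiff_of_approx`): `f - g₀` is penalised by `δ` times the gauge of a weakly compact disc
`K`. Compactness provides a minimiser. The gauge need not be continuous, so the sum rule at the
minimiser rests on the relative continuity of `f`. It is applied to `f` in the first case of the
hypothesis and, with the Mackey topology, to its conjugate in the second. Taking `K` to contain the
polar of a neighbourhood of zero turns the bound `κ ∈ B.polar K` into closeness in the given
topology, by the bipolar theorem. The points obtained converge to `x₀` in `X` itself, hence in every
quotient. -/

theorem AbsConvex.smul_mem_of_abs_le {E : Type*} [AddCommGroup E] [Module ℝ E] {V : Set E}
    (hV : AbsConvex ℝ V) {x : E} (hx : x ∈ V) {t : ℝ} (ht : |t| ≤ 1) : t • x ∈ V :=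
  hV.1.smul_mem (by simpa using ht) hx

/-! ### Neighbourhoods of zero in locally convex spaces. -/

section General

variable {E : Type*} [AddCommGroup E] [Module ℝ E] [TopologicalSpace E]

theorem continuous_of_abs_le_one [IsTopologicalAddGroup E] [ContinuousSMul ℝ E]
    (g : E →ₗ[ℝ] ℝ) {W : Set E} (hW : W ∈ 𝓝 (0 : E)) (h : ∀ w ∈ W, |g w| ≤ 1) :
    Continuous g := by
  refine continuous_of_continuousAt_zero g ?_
  rw [Metric.continuousAt_iff']
  intro ε hε
  have h2 : (ε / 2) • W ∈ 𝓝 (0 : E) := (set_smul_mem_nhds_zero_iff (by positivity)).2 hW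
  filter_upwards [h2] with x hx
  obtain ⟨w, hw, rfl⟩ := hx
  simp only [map_smul, map_zero, smul_eq_mul, Real.dist_eq, sub_zero, abs_mul]
  have := h w hw
  rw [abs_of_pos (show 0 < ε / 2 by positivity)]
  nlinarith [abs_nonneg (g w)]

theorem exists_pos_smul_mem [ContinuousSMul ℝ E] {W : Set E} (hW : W ∈ 𝓝 (0 : E)) (y : E) :
    ∃ c : ℝ, 0 < c ∧ ∀ t : ℝ, |t| ≤ c → t • y ∈ W := by
  have h : ContinuousAt (fun t : ℝ => t • y) 0 := by fun_prop
  have h1 : ∀ᶠ t : ℝ in 𝓝 0, t • y ∈ W := h (by simpa using hW)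
  obtain ⟨c, hc, hc'⟩ := Metric.eventually_nhds_iff.1 h1
  refine ⟨c / 2, by positivity, fun t ht => hc' ?_⟩
  rw [Real.dist_eq, sub_zero]
  linarith

/-- Three summands suit the later estimates, which split an error into three parts. -/
theorem exists_absConvex_closed_nhds [IsTopologicalAddGroup E] [ContinuousSMul ℝ E]
    [LocallyConvexSpace ℝ E] {W : Set E} (hW : W ∈ 𝓝 (0 : E)) :
    ∃ V ∈ 𝓝 (0 : E), AbsConvex ℝ V ∧ IsClosed V ∧
      ∀ a ∈ V, ∀ b ∈ V, ∀ c ∈ V, a + b + c ∈ W := by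
  have h : ContinuousAt (fun p : E × E × E => p.1 + p.2.1 + p.2.2) (0, 0, 0) := by fun_prop
  have h1 : ∀ᶠ p : E × E × E in 𝓝 (0, 0, 0), p.1 + p.2.1 + p.2.2 ∈ W := h (by simpa using hW)
  rw [nhds_prod_eq, nhds_prod_eq] at h1
  obtain ⟨A, hA, A', hA', h2⟩ := Filter.mem_prod_iff.1 h1
  obtain ⟨A2, hA2, A3, hA3, h3⟩ := Filter.mem_prod_iff.1 hA'
  have hI : A ∩ (A2 ∩ A3) ∈ 𝓝 (0 : E) := inter_mem hA (inter_mem hA2 hA3)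
  obtain ⟨C, hC, hCc, hCs⟩ := exists_mem_nhds_isClosed_subset hI
  obtain ⟨D, hD, hDs⟩ := (nhds_hasBasis_absConvex ℝ E).mem_iff.1 hC
  have hcl : closure D ⊆ A ∩ (A2 ∩ A3) := (closure_minimal hDs hCc).trans hCs
  refine ⟨closure D, mem_of_superset hD.1 subset_closure, hD.2.closure, isClosed_closure, ?_⟩
  intro a ha b hb c hc
  exact h2 (Set.mk_mem_prod (hcl ha).1 (h3 (Set.mk_mem_prod (hcl hb).2.1 (hcl hc).2.2)))

end General

/-! ### Weak topology, polars and bipolars. -/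

section Pairing

variable {X Y : Type*} [AddCommGroup X] [Module ℝ X] [AddCommGroup Y] [Module ℝ Y]
  (B : X →ₗ[ℝ] Y →ₗ[ℝ] ℝ)

theorem weakTopology_eq_induced :
    weakTopology B = TopologicalSpace.induced ((LinearMap.ltoFun ℝ Y ℝ ℝ) ∘ₗ B) inferInstance :=
  rfl

theorem weak_isTopologicalAddGroup : @IsTopologicalAddGroup X (weakTopology B) _ := by
  rw [weakTopology_eq_induced]
  exact topologicalAddGroup_induced _

theorem weak_continuousSMul : @ContinuousSMul ℝ X _ _ (weakTopology B) := by
  rw [weakTopology_eq_induced]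
  exact continuousSMul_induced _

theorem weak_t2Space (hB : B.SeparatingLeft) : @T2Space X (weakTopology B) := by
  let := weakTopology B
  refine T2Space.of_injective_continuous (f := fun x : X => fun y : Y => B x y) ?_
    continuous_induced_dom
  intro a b hab
  have : a - b = 0 := hB _ fun y => by
    have := congrFun hab y
    simp only at this
    simp [this]
  exact sub_eq_zero.1 this

theorem weak_continuous_apply (y : Y) : Continuous[weakTopology B, _] (fun x => B x y) := by
  let := weakTopology B
  exact (continuous_apply y).comp (continuous_induced_dom (f := fun x : X => fun y : Y => B x y))

theorem IsDualPair.flip [TopologicalSpace X] [TopologicalSpace Y] {B : X →ₗ[ℝ] Y →ₗ[ℝ] ℝ}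
    (hB : IsDualPair B) : IsDualPair B.flip where
  separatingLeft := LinearMap.flip_separatingLeft.2 hB.separatingRight
  separatingRight := LinearMap.flip_separatingRight.2 hB.separatingLeft
  continuous_left_iff := fun f => hB.continuous_right_iff f
  continuous_right_iff := fun g => hB.continuous_left_iff g

variable {B}

/-- Banach-Alaoglu: inside `Y → ℝ` the polar becomes the set of linear functions bounded by one on
`W`, closed in a product of compact intervals. Compatibility is what makes each such function some
`B x`. -/
theorem isCompact_polar_of_mem_nhds [TopologicalSpace X] [TopologicalSpace Y]
    [IsTopologicalAddGroup Y] [ContinuousSMul ℝ Y] (hB : IsDualPair B) {W : Set Y}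
    (hW : W ∈ 𝓝 (0 : Y)) : @IsCompact X (weakTopology B) (B.flip.polar W) := by
  have hrep := hB.continuous_right_iff
  let := weakTopology B
  have hind : IsInducing (fun x : X => fun y : Y => B x y) := ⟨rfl⟩
  rw [hind.isCompact_iff]
  choose c hc hcW using fun y => exists_pos_smul_mem hW y
  have himg : (fun x : X => fun y : Y => B x y) '' (B.flip.polar W) =
      {g : Y → ℝ | (∀ y z, g (y + z) = g y + g z) ∧ (∀ (t : ℝ) y, g (t • y) = t * g y) ∧
        ∀ w ∈ W, |g w| ≤ 1} := by
    ext g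
    constructor
    · rintro ⟨x, hx, rfl⟩
      exact ⟨fun y z => by simp, fun t y => by simp, fun w hw => hx w hw⟩
    · rintro ⟨h1, h2, h3⟩
      let g' : Y →ₗ[ℝ] ℝ := ⟨⟨g, h1⟩, h2⟩
      obtain ⟨x, hx⟩ := (hrep g').1 (continuous_of_abs_le_one g' hW h3)
      have hx' : ∀ y, g y = B x y := fun y => LinearMap.congr_fun hx y
      refine ⟨x, fun w hw => ?_, ?_⟩
      · simpa [← hx'] using h3 w hw
      · ext y
        exact (hx' y).symm
  rw [himg]
  refine IsCompact.of_isClosed_subset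
    (isCompact_univ_pi fun y : Y => isCompact_Icc (a := -(1 / c y)) (b := 1 / c y)) ?_ ?_
  · simp only [Set.ofPred_and, Set.ofPred_forall]
    refine IsClosed.inter ?_ (IsClosed.inter ?_ ?_)
    · exact isClosed_iInter fun y => isClosed_iInter fun z =>
        isClosed_eq (by fun_prop) (by fun_prop)
    · exact isClosed_iInter fun y => isClosed_iInter fun z =>
        isClosed_eq (by fun_prop) (by fun_prop)
    · exact isClosed_iInter fun y => isClosed_iInter fun z =>
        isClosed_le (by fun_prop) (by fun_prop)
  · rintro g ⟨h1, h2, h3⟩ y -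
    have h4 := h3 _ (hcW y (c y) (abs_of_pos (hc y)).le)
    rw [h2, abs_mul, abs_of_pos (hc y)] at h4
    rw [Set.mem_Icc, ← abs_le, le_div_iff₀ (hc y)]
    linarith

theorem IsDualPair.exists_right [TopologicalSpace X] [TopologicalSpace Y] (hB : IsDualPair B)
    (f : StrongDual ℝ X) : ∃ y, ∀ x, f x = B x y := by
  obtain ⟨y, hy⟩ := (hB.continuous_left_iff f.toLinearMap).1 f.continuous
  exact ⟨y, fun x => LinearMap.congr_fun hy x⟩

theorem IsDualPair.continuous_apply_left [TopologicalSpace X] [TopologicalSpace Y]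
    (hB : IsDualPair B) (y : Y) : Continuous fun x => B x y :=
  (hB.continuous_left_iff (B.flip y)).2 ⟨y, rfl⟩

theorem IsDualPair.continuous_apply_right [TopologicalSpace X] [TopologicalSpace Y]
    (hB : IsDualPair B) (x : X) : Continuous fun y => B x y :=
  (hB.continuous_right_iff (B x)).2 ⟨x, rfl⟩

/-- Bipolar theorem. -/
theorem bipolar_subset [TopologicalSpace X] [TopologicalSpace Y] [IsTopologicalAddGroup X]
    [ContinuousSMul ℝ X] [LocallyConvexSpace ℝ X] (hB : IsDualPair B) {V : Set X}
    (hV : AbsConvex ℝ V) (hVc : IsClosed V) (hV0 : V.Nonempty) :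
    B.flip.polar (B.polar V) ⊆ V := by
  intro x hx
  by_contra hxV
  obtain ⟨f, u, hfu, hux⟩ := geometric_hahn_banach_closed_point hV.2 hVc hxV
  obtain ⟨y, hy⟩ := hB.exists_right f
  have hu : 0 < u := by
    obtain ⟨v, hv⟩ := hV0
    have := hfu _ (AbsConvex.smul_mem_of_abs_le hV hv (t := 0) (by simp))
    simpa using this
  have hmem : u⁻¹ • y ∈ B.polar V := by
    intro v hv
    have h1 := hfu v hv
    have h2 := hfu _ (AbsConvex.smul_mem_of_abs_le hV hv (t := -1) (by simp))
    rw [hy] at h1 h2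
    simp only [neg_smul, one_smul, map_neg, LinearMap.neg_apply] at h2
    rw [map_smul, smul_eq_mul, Real.norm_eq_abs, abs_mul, abs_of_pos (inv_pos.2 hu),
      inv_mul_le_iff₀ hu, mul_one, abs_le]
    constructor <;> linarith
  have h3 := hx _ hmem
  rw [LinearMap.flip_apply, map_smul, smul_eq_mul, Real.norm_eq_abs, abs_mul,
    abs_of_pos (inv_pos.2 hu), inv_mul_le_iff₀ hu, mul_one] at h3
  rw [hy] at hux
  linarith [le_abs_self (B x y)]

/-- An absolutely convex weakly compact set is bounded for every compatible topology. -/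
theorem exists_smul_mem_of_weakly_compact [TopologicalSpace X] [TopologicalSpace Y]
    [IsTopologicalAddGroup X] [ContinuousSMul ℝ X] [LocallyConvexSpace ℝ X] (hB : IsDualPair B)
    {K : Set X} (hK : AbsConvex ℝ K) (hKc : @IsCompact X (weakTopology B) K) {U : Set X}
    (hU : U ∈ 𝓝 (0 : X)) : ∃ r : ℝ, 0 < r ∧ ∀ t : ℝ, |t| ≤ r → ∀ k ∈ K, t • k ∈ U := by
  classical
  obtain ⟨V, hV, hVa, hVc, hVU⟩ := exists_absConvex_closed_nhds hU
  have hV0 : (0 : X) ∈ V := mem_of_mem_nhds hV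
  have hVU' : V ⊆ U := fun v hv => by simpa using hVU v hv 0 hV0 0 hV0
  choose c hc hcV using fun x => exists_pos_smul_mem hV x
  rcases K.eq_empty_or_nonempty with rfl | hKne
  · exact ⟨1, one_pos, by simp⟩
  have hsep := hB.separatingLeft
  have hbip := bipolar_subset hB hVa hVc ⟨0, hV0⟩
  let tw := weakTopology B
  have := weak_isTopologicalAddGroup B
  have := weak_continuousSMul B
  have := weak_t2Space B hsep
  -- By the bipolar theorem `V` is an intersection of weakly closed strips.
  have hVw : IsClosed V := by
    have : V = ⋂ y ∈ B.polar V, {x | |B x y| ≤ 1} := by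
      ext x
      simp only [Set.mem_iInter]
      constructor
      · intro hx y hy
        exact hy x hx
      · intro hx
        exact hbip fun y hy => hx y hy
    rw [this]
    refine isClosed_biInter fun y _ => isClosed_le ?_ continuous_const
    exact (weak_continuous_apply B y).abs
  have : CompactSpace K := isCompact_iff_compactSpace.1 hKc
  have : Nonempty K := hKne.to_subtype
  -- Baire's theorem in the weakly compact `K`: `V` is absorbing, so these closed sets cover `K` and
  -- one has an interior point `k₀`. The tube lemma then shrinks all of `K` towards `k₀` by one
  -- factor `t`, into that interior.
  let S : ℕ → Set K := fun n => {k | ((n : ℝ) + 1)⁻¹ • (k : X) ∈ V}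
  obtain ⟨n, ⟨k₀, hk₀⟩⟩ := nonempty_interior_of_iUnion_of_closed (f := S)
    (fun n => hVw.preimage (by fun_prop)) (by
      rw [Set.eq_univ_iff_forall]
      intro k
      obtain ⟨n, hn⟩ := exists_nat_gt (c k)⁻¹
      refine Set.mem_iUnion.2 ⟨n, hcV _ _ ?_⟩
      rw [abs_of_pos (by positivity)]
      exact inv_le_of_inv_le₀ (hc _) (by linarith))
  let φ : ℝ × K → X := fun p => (k₀ : X) + p.1 • ((p.2 : X) - k₀)
  have hφ : Continuous φ := by fun_prop
  obtain ⟨O, hO, hOS⟩ := isOpen_induced_iff.1 (isOpen_interior (s := S n))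
  have hO0 : (k₀ : X) ∈ O := by
    have : k₀ ∈ Subtype.val ⁻¹' O := by rw [hOS]; exact hk₀
    exact this
  obtain ⟨A, A', hA, -, hA0, hA', hAA⟩ := generalized_tube_lemma
    (isCompact_singleton (x := (0 : ℝ))) (isCompact_univ (X := K)) (hO.preimage hφ) (by
      rintro ⟨t, k⟩ ⟨ht, -⟩
      obtain rfl : t = 0 := ht
      simpa [φ] using hO0)
  obtain ⟨ε, hε, hεA⟩ := Metric.isOpen_iff.1 hA 0 (hA0 rfl)
  let t := min (ε / 2) 1
  have ht : 0 < t := by positivity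
  have ht1 : t ≤ 1 := min_le_right _ _
  have htA : t ∈ A := hεA (by
    rw [Metric.mem_ball, Real.dist_eq, sub_zero, abs_of_pos ht]
    have : t ≤ ε / 2 := min_le_left _ _
    linarith)
  let N : ℝ := (n : ℝ) + 1
  have hN : 0 < N := by positivity
  have key : ∀ x ∈ K, N⁻¹ • ((k₀ : X) + t • (x - k₀)) ∈ V := by
    intro x hx
    have h1 : φ (t, ⟨x, hx⟩) ∈ O := hAA (Set.mk_mem_prod htA (hA' trivial))
    have h2 : (k₀ : X) + t • (x - k₀) ∈ K := by
      have := hK.2 k₀.2 hx (sub_nonneg.2 ht1) ht.le (by ring)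
      convert this using 1
      module
    have h3 : (⟨_, h2⟩ : K) ∈ interior (S n) := by
      rw [← hOS]; exact h1
    have h4 : (⟨_, h2⟩ : K) ∈ S n := interior_subset h3
    exact h4
  have h0K : (0 : X) ∈ K := by
    simpa using AbsConvex.smul_mem_of_abs_le hK k₀.2 (t := 0) (by simp)
  refine ⟨t * N⁻¹ / 2, by positivity, fun s hs k hk => hVU' ?_⟩
  -- Half the difference of the memberships at `k` and at `0` eliminates `k₀`.
  have h1 := key k hk
  have h2 := key 0 h0K
  have h3 := hVa.2 h1 (AbsConvex.smul_mem_of_abs_le hVa h2 (t := -1) (by simp))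
    (by norm_num : (0 : ℝ) ≤ 1 / 2) (by norm_num : (0 : ℝ) ≤ 1 / 2) (by norm_num)
  have h4 := AbsConvex.smul_mem_of_abs_le hVa h3 (t := s / (t * N⁻¹ / 2)) (by
    rw [abs_div, abs_of_pos (show 0 < t * N⁻¹ / 2 by positivity)]
    exact div_le_one_of_le₀ hs (by positivity))
  have h5 : (1 / 2 : ℝ) • N⁻¹ • ((k₀ : X) + t • (k - k₀)) +
      (1 / 2 : ℝ) • (-1 : ℝ) • N⁻¹ • ((k₀ : X) + t • (0 - k₀)) = (t * N⁻¹ / 2) • k := by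
    module
  rw [h5, smul_smul, div_mul_cancel₀ _ (by positivity)] at h4
  exact h4

end Pairing

/-! ### The Mackey topology and its dual. -/

section Mackey

variable {X Y : Type*} [AddCommGroup X] [Module ℝ X] [AddCommGroup Y] [Module ℝ Y]
  (B : X →ₗ[ℝ] Y →ₗ[ℝ] ℝ)

/-- The absolutely convex weakly compact subsets of `X`. -/
def weakDiscs : Set (Set X) :=
  {K : Set X | Convex ℝ K ∧ Balanced ℝ K ∧ @IsCompact X (weakTopology B) K}

variable {B}

theorem add_mem_weakDiscs {K L : Set X} (hK : K ∈ weakDiscs B) (hL : L ∈ weakDiscs B) :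
    K + L ∈ weakDiscs B := by
  let := weakTopology B
  have := weak_isTopologicalAddGroup B
  exact ⟨hK.1.add hL.1, hK.2.1.add hL.2.1, hK.2.2.add hL.2.2⟩

theorem smul_mem_weakDiscs {K : Set X} (hK : K ∈ weakDiscs B) (c : ℝ) :
    c • K ∈ weakDiscs B := by
  let := weakTopology B
  have := weak_isTopologicalAddGroup B
  have := weak_continuousSMul B
  exact ⟨hK.1.smul c, hK.2.1.smul c, hK.2.2.smul c⟩

variable (B) in
theorem segment_mem_weakDiscs (x : X) :
    (fun t : ℝ => t • x) '' Set.Icc (-1) 1 ∈ weakDiscs B := by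
  let := weakTopology B
  have := weak_isTopologicalAddGroup B
  have := weak_continuousSMul B
  refine ⟨?_, ?_, isCompact_Icc.image (by fun_prop)⟩
  · exact (convex_Icc _ _).is_linear_image ⟨fun a b => add_smul a b x, fun c a => mul_smul c a x⟩
  · rintro a ha _ ⟨_, ⟨t, ht, rfl⟩, rfl⟩
    rw [Real.norm_eq_abs] at ha
    refine ⟨a * t, ?_, mul_smul a t x⟩
    rw [Set.mem_Icc, ← abs_le, abs_mul]
    exact mul_le_one₀ ha (abs_nonneg _) (abs_le.2 ht)

theorem subset_add_weakDiscs_left {K L : Set X} (hL : L ∈ weakDiscs B) (hL0 : L.Nonempty) :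
    K ⊆ K + L := fun k hk =>
  ⟨k, hk, 0, hL.2.1.zero_mem hL0, add_zero k⟩

theorem directedOn_weakDiscs : DirectedOn (· ⊆ ·) (weakDiscs B) := by
  intro K hK L hL
  rcases K.eq_empty_or_nonempty with rfl | hK0
  · exact ⟨L, hL, Set.empty_subset _, subset_rfl⟩
  rcases L.eq_empty_or_nonempty with rfl | hL0
  · exact ⟨K, hK, subset_rfl, Set.empty_subset _⟩
  refine ⟨K + L, add_mem_weakDiscs hK hL, subset_add_weakDiscs_left hL hL0, ?_⟩
  rw [add_comm K L]
  exact subset_add_weakDiscs_left hK hK0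

variable (B)

/-- Evaluation of `y` on `X`, as a linear map. -/
def evalFun : Y →ₗ[ℝ] (X → ℝ) := (LinearMap.ltoFun ℝ X ℝ ℝ) ∘ₗ B.flip

theorem mackey_isTopologicalAddGroup : @IsTopologicalAddGroup Y (mackeyTopology B) _ := by
  let ofFun' : (X → ℝ) →+ (UniformOnFun X ℝ (weakDiscs B)) := AddMonoidHom.id _
  let := mackeyTopology B
  exact IsInducing.topologicalAddGroup (ofFun'.comp (evalFun B : Y →+ (X → ℝ))) ⟨rfl⟩

theorem mackey_continuousSMul : @ContinuousSMul ℝ Y _ _ (mackeyTopology B) := by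
  let := mackeyTopology B
  refine UniformOnFun.continuousSMul_induced_of_image_bounded (𝔖 := weakDiscs B) ℝ X ℝ Y
    (evalFun B) ⟨rfl⟩ ?_
  intro y K hK
  rw [NormedSpace.isVonNBounded_iff]
  let := weakTopology B
  exact (hK.2.2.image (weak_continuous_apply B y)).isBounded

theorem mackey_hasBasis : (@nhds Y (mackeyTopology B) 0).HasBasis
    (fun p : Set X × ℝ => p.1 ∈ weakDiscs B ∧ 0 < p.2)
    fun p => {y | ∀ x ∈ p.1, |B x y| < p.2} := by
  have h := (UniformOnFun.hasBasis_nhds_zero_of_basis (weakDiscs B)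
    ⟨_, segment_mem_weakDiscs B 0⟩ directedOn_weakDiscs
    (Metric.nhds_basis_ball (x := (0 : ℝ)))).comap
      (fun y : Y => UniformOnFun.ofFun (weakDiscs B) (fun x : X => B x y))
  rw [nhds_induced]
  convert h using 1
  · simp only [map_zero]
    rfl
  · ext p y
    simp [UniformOnFun.toFun_ofFun]

theorem mackey_locallyConvexSpace : @LocallyConvexSpace ℝ Y _ _ _ _ (mackeyTopology B) := by
  let := mackeyTopology B
  have := mackey_isTopologicalAddGroup B
  refine LocallyConvexSpace.ofBasisZero ℝ Y _ _ (mackey_hasBasis B) ?_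
  rintro ⟨K, ε⟩ -
  have : {y | ∀ x ∈ K, |B x y| < ε} = ⋂ x ∈ K, (B x) ⁻¹' (Metric.ball 0 ε) := by
    ext y; simp
  rw [this]
  exact convex_iInter₂ fun x _ => (convex_ball 0 ε).linear_preimage (B x)

variable {B}

/-- This is the bipolar theorem in the algebraic dual of `Y` with its weak topology: there the image
of `K` is compact, hence closed, and every continuous functional is evaluation at some `y`. -/
theorem mem_image_of_abs_le_on_polar {K : Set X} (hK : K ∈ weakDiscs B) (hK0 : K.Nonempty)
    (g : Y →ₗ[ℝ] ℝ) (hg : ∀ y ∈ B.polar K, |g y| ≤ 1) : ∃ x ∈ K, g = B x := by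
  let P : Module.Dual ℝ Y →ₗ[ℝ] Y →ₗ[ℝ] ℝ := LinearMap.id
  let ι : X →ₗ[ℝ] WeakBilin P := B
  by_contra hcon
  push Not at hcon
  have hT2 : T2Space (WeakBilin P) :=
    (WeakBilin.isEmbedding (B := P) Function.injective_id).t2Space
  have hcomp : IsCompact (ι '' K) := by
    let := weakTopology B
    exact hK.2.2.image (WeakBilin.continuous_of_continuous_eval P
      fun y => weak_continuous_apply B y)
  have hconv : Convex ℝ (ι '' K) := hK.1.linear_image ι
  obtain ⟨f, u, hfu, hug⟩ := geometric_hahn_banach_closed_point (E := WeakBilin P) (x := g) hconv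
    hcomp.isClosed (by rintro ⟨x, hx, hxg⟩; exact hcon x hx hxg.symm)
  obtain ⟨y, hy⟩ := LinearMap.dualEmbedding_surjective P f
  have hf : ∀ φ : WeakBilin P, f φ = P φ y := fun φ => by rw [← hy]; rfl
  have h1 : ∀ x ∈ K, B x y < u := fun x hx => by
    have := hfu _ ⟨x, hx, rfl⟩
    rwa [hf] at this
  have h2 : u < g y := hug.trans_eq (hf g)
  have hu : 0 < u := by
    have := h1 0 (hK.2.1.zero_mem hK0)
    simpa using this
  have hmem : u⁻¹ • y ∈ B.polar K := by
    intro v hv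
    have h3 := h1 v hv
    have h4 := h1 (-v) (hK.2.1.neg_mem_iff.2 hv)
    simp only [map_neg, LinearMap.neg_apply] at h4
    rw [map_smul, smul_eq_mul, Real.norm_eq_abs, abs_mul, abs_of_pos (inv_pos.2 hu),
      inv_mul_le_iff₀ hu, mul_one, abs_le]
    constructor <;> linarith
  have h5 := hg _ hmem
  rw [map_smul, smul_eq_mul, abs_mul, abs_of_pos (inv_pos.2 hu), inv_mul_le_iff₀ hu, mul_one] at h5
  linarith [le_abs_self (g y)]

/-- Mackey-Arens theorem. -/
theorem mackey_continuous_iff (g : Y →ₗ[ℝ] ℝ) :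
    Continuous[mackeyTopology B, _] g ↔ ∃ x : X, g = B x := by
  let := mackeyTopology B
  have := mackey_isTopologicalAddGroup B
  have := mackey_continuousSMul B
  constructor
  · intro hg
    have h0 : ∀ᶠ y in 𝓝 (0 : Y), |g y| < 1 := by
      have : ContinuousAt (fun y => |g y|) 0 := hg.abs.continuousAt
      exact this.eventually_lt_const (by simp)
    obtain ⟨⟨K, ε⟩, ⟨hK, hε⟩, hKε⟩ := (mackey_hasBasis B).mem_iff.1 h0
    dsimp only at hK hε hKε
    rcases K.eq_empty_or_nonempty with rfl | hK0
    -- With `K` empty the neighbourhood is all of `Y`, and a bounded linear functional vanishes.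
    · refine ⟨0, ?_⟩
      ext y
      by_contra hne
      simp only [map_zero, LinearMap.zero_apply] at hne
      have h1 : |g ((g y)⁻¹ • y)| < 1 := hKε (by simp)
      rw [map_smul, smul_eq_mul, inv_mul_cancel₀ hne] at h1
      simp at h1
    -- The factor `2 / ε` gives `|B k y| ≤ ε / 2` on the polar, which meets the strict inequality in
    -- the basic neighbourhood.
    · obtain ⟨x, -, hx⟩ := mem_image_of_abs_le_on_polar (smul_mem_weakDiscs hK (2 / ε))
        (hK0.smul_set) g (by
          intro y hy
          refine (show |g y| < 1 from hKε fun k hk => ?_).le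
          have h1 := hy _ (Set.smul_mem_smul_set hk)
          rw [map_smul, LinearMap.smul_apply, smul_eq_mul, Real.norm_eq_abs, abs_mul,
            abs_of_pos (by positivity : 0 < 2 / ε), div_mul_eq_mul_div, div_le_one hε] at h1
          have := abs_nonneg (B k y)
          linarith)
      exact ⟨x, hx⟩
  · rintro ⟨x, rfl⟩
    refine continuous_of_abs_le_one (B x) ((mackey_hasBasis B).mem_of_mem
      (i := (_, 1)) ⟨segment_mem_weakDiscs B x, one_pos⟩) ?_
    intro y hy
    have := hy x ⟨1, by simp, one_smul _ _⟩
    exact this.le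

theorem IsDualPair.mackey_flip [TopologicalSpace X] [TopologicalSpace Y] (hB : IsDualPair B) :
    @IsDualPair Y X _ _ (mackeyTopology B) _ _ _ B.flip :=
  @IsDualPair.mk Y X _ _ (mackeyTopology B) _ _ _ B.flip
    (LinearMap.flip_separatingLeft.2 hB.separatingRight)
    (LinearMap.flip_separatingRight.2 hB.separatingLeft)
    (fun g => mackey_continuous_iff g)
    (fun f => hB.continuous_left_iff f)

end Mackey

/-! ### Conjugates, Fenchel-Moreau and approximate subgradients. -/

section Conjugate

variable {X Y : Type*} [AddCommGroup X] [Module ℝ X] [AddCommGroup Y] [Module ℝ Y]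
  {B : X →ₗ[ℝ] Y →ₗ[ℝ] ℝ}

theorem EReal_eq_of_forall_le {a b : EReal} (h : ∀ r : ℝ, a ≤ r ↔ b ≤ r) : a = b := by
  apply le_antisymm
  · exact EReal.le_of_forall_lt_iff_le.1 fun z hz => (h z).2 hz.le
  · exact EReal.le_of_forall_lt_iff_le.1 fun z hz => (h z).1 hz.le

/-- Quantifying over real upper bounds `s` makes the value `⊤` vacuous, so conjugates and
subgradients can be handled through real inequalities alone. -/
theorem coe_sub_le_coe_iff {a : EReal} (ha : a ≠ ⊥) (b r : ℝ) :
    (b : EReal) - a ≤ r ↔ ∀ s : ℝ, a ≤ s → b - s ≤ r := by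
  induction a using EReal.rec with
  | bot => exact absurd rfl ha
  | top => simp
  | coe a =>
    rw [← EReal.coe_sub, EReal.coe_le_coe_iff]
    constructor
    · intro h s hs
      have := EReal.coe_le_coe_iff.1 hs
      linarith
    · intro h
      exact h a le_rfl

theorem conj_le_iff {f : X → EReal} (hf : ∀ x, f x ≠ ⊥) (y : Y) (r : ℝ) :
    conj B f y ≤ r ↔ ∀ x (s : ℝ), f x ≤ s → B x y - s ≤ r := by
  rw [conj, iSup_le_iff]
  exact forall_congr' fun x => coe_sub_le_coe_iff (hf x) _ _

theorem conj_ne_bot {f : X → EReal} (hf : (dom f).Nonempty) (hbot : ∀ x, f x ≠ ⊥) (y : Y) :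
    conj B f y ≠ ⊥ := by
  obtain ⟨x, hx⟩ := hf
  intro h
  have hx' : f x = ((f x).toReal : EReal) := (EReal.coe_toReal hx.ne (hbot x)).symm
  have h1 := (conj_le_iff hbot y (B x y - (f x).toReal - 1)).1 (by rw [h]; exact bot_le) x _ hx'.le
  linarith

theorem convex_epi_conj {f : X → EReal} (hf : ∀ x, f x ≠ ⊥) : Convex ℝ (epi (conj B f)) := by
  intro p hp q hq a b ha hb hab
  simp only [epi, Set.mem_ofPred_eq] at hp hq ⊢
  rw [conj_le_iff hf] at hp hq ⊢
  intro x s hs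
  have h1 := hp x s hs
  have h2 := hq x s hs
  simp only [Prod.fst_add, Prod.smul_fst, Prod.snd_add, Prod.smul_snd, map_add, map_smul,
    smul_eq_mul]
  obtain rfl : b = 1 - a := by linarith
  nlinarith

theorem lowerSemicontinuous_conj (f : X → EReal) :
    @LowerSemicontinuous _ _ (weakTopology B.flip) _ (conj B f) := by
  let := weakTopology B.flip
  refine lowerSemicontinuous_iSup fun x => Continuous.lowerSemicontinuous ?_
  have hc : Continuous fun y => ((B x y : ℝ) : EReal) :=
    continuous_coe_real_ereal.comp (weak_continuous_apply B.flip x)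
  induction f x using EReal.rec with
  | bot => simpa [sub_eq_add_neg] using continuous_const
  | top => simpa [sub_eq_add_neg] using continuous_const
  | coe a =>
    have : (fun y => ((B x y : ℝ) : EReal) - a) = fun y => ((B x y - a : ℝ) : EReal) := by
      ext y; rw [EReal.coe_sub]
    rw [this]
    exact continuous_coe_real_ereal.comp
      ((weak_continuous_apply B.flip x).sub continuous_const)

theorem mem_subdiff_iff {f : X → EReal} (hf : ∀ x, f x ≠ ⊥) {x : X} {a : ℝ} (hx : f x = a)
    (y : Y) : y ∈ subdiff B f x ↔ ∀ u (s : ℝ), f u ≤ s → B (u - x) y ≤ s - a := by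
  have hdom : x ∈ dom f := by
    rw [dom, Set.mem_ofPred_eq, hx]; exact EReal.coe_lt_top a
  simp only [subdiff, Set.mem_ofPred_eq, hdom, true_and, hx]
  refine forall_congr' fun u => ?_
  have hu := hf u
  induction h : f u using EReal.rec with
  | bot => exact absurd h hu
  | top => simp
  | coe b =>
    rw [← EReal.coe_sub, EReal.coe_le_coe_iff]
    constructor
    · intro h s hs
      have := EReal.coe_le_coe_iff.1 hs
      linarith
    · intro h
      exact h b le_rfl

variable [TopologicalSpace X] [TopologicalSpace Y]

theorem IsDualPair.exists_right_prod (hB : IsDualPair B) (f : StrongDual ℝ (X × ℝ)) :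
    ∃ (y : Y) (α : ℝ), ∀ (x : X) (s : ℝ), f (x, s) = B x y + s * α := by
  obtain ⟨y, hy⟩ := hB.exists_right (f.comp (ContinuousLinearMap.inl ℝ X ℝ))
  refine ⟨y, f (0, 1), fun x s => ?_⟩
  have h1 : (x, s) = (x, (0 : ℝ)) + s • ((0 : X), (1 : ℝ)) := by simp
  rw [h1, map_add, map_smul, smul_eq_mul, ← hy]
  simp

variable [IsTopologicalAddGroup X] [ContinuousSMul ℝ X] [LocallyConvexSpace ℝ X]

/-- A separating hyperplane of the epigraph yields an affine minorant if it is not vertical. A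
vertical one is repaired by adding a large multiple of it to some fixed affine minorant. -/
theorem exists_affine_of_not_le (hB : IsDualPair B) {f : X → EReal} (hf : IsGammaZero f) {x : X}
    {r : ℝ} (hr : ¬ f x ≤ r) : ∃ (y : Y) (c : ℝ), conj B f y ≤ c ∧ r < B x y - c := by
  have sep : ∀ (x : X) (r : ℝ), ¬ f x ≤ r → ∃ (y : Y) (α u : ℝ),
      (∀ z (s : ℝ), f z ≤ s → B z y + s * α < u) ∧ u < B x y + r * α := by
    intro x r hr
    obtain ⟨ℓ, u, h1, h2⟩ := geometric_hahn_banach_closed_point (x := (x, r)) hf.convex_epi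
      hf.isClosed_epi hr
    obtain ⟨y, α, hy⟩ := hB.exists_right_prod ℓ
    refine ⟨y, α, u, fun z s hz => ?_, ?_⟩
    · rw [← hy]; exact h1 (z, s) hz
    · rw [← hy]; exact h2
  have nonvert : ∀ (x : X) (r : ℝ) (y : Y) (α u : ℝ),
      (∀ z (s : ℝ), f z ≤ s → B z y + s * α < u) → u < B x y + r * α → α < 0 →
      ∃ (y : Y) (c : ℝ), conj B f y ≤ c ∧ r < B x y - c := by
    intro x r y α u h1 h2 hα
    have hα' : 0 < -α := by linarith
    refine ⟨(-α)⁻¹ • y, (-α)⁻¹ * u, (conj_le_iff hf.ne_bot _ _).2 fun z s hz => ?_, ?_⟩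
    · have := h1 z s hz
      rw [map_smul, smul_eq_mul, sub_le_iff_le_add, inv_mul_le_iff₀ hα', mul_add, mul_inv_cancel_left₀
        hα'.ne']
      linarith
    · rw [map_smul, smul_eq_mul, ← mul_sub, lt_inv_mul_iff₀ hα']
      linarith
  obtain ⟨x₁, hx₁⟩ := hf.dom_nonempty
  have hx₁' : f x₁ = ((f x₁).toReal : EReal) := (EReal.coe_toReal hx₁.ne (hf.ne_bot x₁)).symm
  obtain ⟨y₁, c₁, hc₁, -⟩ : ∃ (y : Y) (c : ℝ), conj B f y ≤ c ∧ (f x₁).toReal - 1 < B x₁ y - c := by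
    -- Separating a point strictly below the graph over the domain cannot give a vertical
    -- hyperplane.
    obtain ⟨y, α, u, h1, h2⟩ := sep x₁ ((f x₁).toReal - 1) (by
      rw [hx₁', EReal.coe_le_coe_iff, EReal.toReal_coe]
      linarith)
    refine nonvert _ _ y α u h1 h2 ?_
    have := h1 x₁ _ hx₁'.le
    nlinarith
  obtain ⟨y, α, u, h1, h2⟩ := sep x r hr
  have hα : α ≤ 0 := by
    by_contra! hα
    set a := (f x₁).toReal
    have h3 := h1 x₁ (max a ((u - B x₁ y) / α)) (by
      rw [hx₁']; exact EReal.coe_le_coe_iff.2 (le_max_left _ _))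
    have h4 : (u - B x₁ y) / α ≤ max a ((u - B x₁ y) / α) := le_max_right _ _
    rw [div_le_iff₀ hα] at h4
    linarith
  rcases hα.lt_or_eq with hα | rfl
  · exact nonvert x r y α u h1 h2 hα
  · simp only [mul_zero, add_zero] at h1 h2
    rw [conj_le_iff hf.ne_bot] at hc₁
    obtain ⟨t, ht0, ht⟩ : ∃ t : ℝ, 0 ≤ t ∧ r - (B x y₁ - c₁) < t * (B x y - u) := by
      have hpos : 0 < B x y - u := by linarith
      refine ⟨(|r - (B x y₁ - c₁)| + 1) / (B x y - u), by positivity, ?_⟩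
      rw [div_mul_cancel₀ _ hpos.ne']
      linarith [le_abs_self (r - (B x y₁ - c₁))]
    refine ⟨y₁ + t • y, c₁ + t * u, (conj_le_iff hf.ne_bot _ _).2 fun z s hz => ?_, ?_⟩
    · have h3 := hc₁ z s hz
      have h4 := h1 z s hz
      simp only [map_add, map_smul, smul_eq_mul]
      nlinarith
    · simp only [map_add, map_smul, smul_eq_mul]
      linarith

theorem dom_conj_nonempty (hB : IsDualPair B) {f : X → EReal} (hf : IsGammaZero f) :
    (dom (conj B f)).Nonempty := by
  obtain ⟨x, hx⟩ := hf.dom_nonempty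
  obtain ⟨y, c, hc, -⟩ := exists_affine_of_not_le hB hf (x := x) (r := (f x).toReal - 1) (by
    rw [← EReal.coe_toReal hx.ne (hf.ne_bot x), EReal.coe_le_coe_iff, EReal.toReal_coe]
    linarith)
  exact ⟨y, hc.trans_lt (EReal.coe_lt_top c)⟩

/-- Fenchel-Moreau theorem. -/
theorem conj_conj (hB : IsDualPair B) {f : X → EReal} (hf : IsGammaZero f) :
    conj B.flip (conj B f) = f := by
  have hbot := conj_ne_bot (B := B) hf.dom_nonempty hf.ne_bot
  ext x
  refine EReal_eq_of_forall_le fun r => ?_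
  rw [conj_le_iff hbot]
  constructor
  · intro h
    by_contra hr
    obtain ⟨y, c, hc, hlt⟩ := exists_affine_of_not_le hB hf hr
    have := h y c hc
    rw [LinearMap.flip_apply] at this
    linarith
  · intro h y s hs
    have := (conj_le_iff hf.ne_bot y s).1 hs x r h
    rw [LinearMap.flip_apply]
    linarith

/-- Biconjugation turns the subgradient inequality for the conjugate into `f x ≤ B x y - conj B f
y`, the equality case of Young's inequality. -/
theorem mem_subdiff_of_mem_subdiff_conj (hB : IsDualPair B) {f : X → EReal} (hf : IsGammaZero f)
    {x : X} {y : Y} (h : x ∈ subdiff B.flip (conj B f) y) : y ∈ subdiff B f x := by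
  have hbot := conj_ne_bot (B := B) hf.dom_nonempty hf.ne_bot
  have hb : conj B f y = ((conj B f y).toReal : EReal) := (EReal.coe_toReal h.1.ne (hbot y)).symm
  set b := (conj B f y).toReal
  have h1 := (mem_subdiff_iff hbot hb x).1 h
  have h2 := (conj_le_iff hf.ne_bot y b).1 hb.le
  have h3 : f x ≤ ((B x y - b : ℝ) : EReal) := by
    rw [← conj_conj hB hf, conj_le_iff hbot]
    intro z s hs
    have := h1 z s hs
    simp only [LinearMap.flip_apply, map_sub, LinearMap.sub_apply] at this ⊢
    linarith
  have h4 : f x = ((f x).toReal : EReal) :=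
    (EReal.coe_toReal (h3.trans_lt (EReal.coe_lt_top _)).ne (hf.ne_bot x)).symm
  rw [mem_subdiff_iff hf.ne_bot h4]
  intro u s hs
  have h5 := h2 u s hs
  rw [h4, EReal.coe_le_coe_iff] at h3
  simp only [map_sub, LinearMap.sub_apply]
  linarith

variable [IsTopologicalAddGroup Y] [ContinuousSMul ℝ Y] [LocallyConvexSpace ℝ Y]

/-- Elements of the normal cone to a sublevel set are limits of scaled approximate subgradients. -/
theorem exists_approx_of_mem_normalCone (hB : IsDualPair B) {f : X → EReal} (hf : IsGammaZero f)
    {x₀ : X} {a : ℝ} (hx₀ : f x₀ = a) {v : Y} (hv : v ∈ normalCone B (sublevel f (f x₀)) x₀)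
    {W : Set Y} (hW : W ∈ 𝓝 (0 : Y)) {η : ℝ} (hη : 0 < η) :
    ∃ (μ : ℝ) (y : Y) (ε : ℝ), 0 < μ ∧ 0 ≤ ε ∧ μ * ε < η ∧ μ • y - v ∈ W ∧
      ∀ u (s : ℝ), f u ≤ s → B (u - x₀) y ≤ s - a + ε := by
  -- For `(z, ρ) ∈ C` with witness `μ`, the vector `μ⁻¹ • z` is a `μ⁻¹ * ρ`-subgradient at `x₀`. The
  -- goal amounts to `(v, 0)` lying in the closure of this cone.
  let C : Set (Y × ℝ) := {p | ∃ μ : ℝ, 0 < μ ∧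
    ∀ x (s : ℝ), f x ≤ s → B (x - x₀) p.1 ≤ μ * (s - a) + p.2}
  have hC : Convex ℝ C := by
    rintro p ⟨μ, hμ, hp⟩ q ⟨ν, hν, hq⟩ α β hα hβ hαβ
    refine ⟨α * μ + β * ν, ?_, fun x s hs => ?_⟩
    · rcases hα.eq_or_lt with rfl | hα
      · have : β = 1 := by linarith
        simpa [this] using hν
      · have := mul_pos hα hμ
        have := mul_nonneg hβ hν.le
        linarith
    · have h1 := mul_le_mul_of_nonneg_left (hp x s hs) hα
      have h2 := mul_le_mul_of_nonneg_left (hq x s hs) hβ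
      simp only [Prod.fst_add, Prod.smul_fst, Prod.snd_add, Prod.smul_snd, map_add, map_smul,
        smul_eq_mul]
      linarith
  have hsmul : ∀ p ∈ C, ∀ t : ℝ, 0 < t → t • p ∈ C := by
    rintro p ⟨μ, hμ, hp⟩ t ht
    refine ⟨t * μ, mul_pos ht hμ, fun x s hs => ?_⟩
    have h1 := mul_le_mul_of_nonneg_left (hp x s hs) ht.le
    simp only [Prod.smul_fst, Prod.smul_snd, map_smul, smul_eq_mul]
    linarith
  have hmemC : ∀ (y : Y) (c : ℝ), conj B f y ≤ c → (y, c - B x₀ y + a) ∈ C := by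
    intro y c hc
    refine ⟨1, one_pos, fun x s hs => ?_⟩
    have := (conj_le_iff hf.ne_bot y c).1 hc x s hs
    simp only [map_sub, LinearMap.sub_apply]
    linarith
  have hne : ∃ p, p ∈ C := by
    obtain ⟨y, hy⟩ := dom_conj_nonempty hB hf
    exact ⟨_, hmemC y _ (EReal.coe_toReal hy.ne
      (conj_ne_bot hf.dom_nonempty hf.ne_bot y)).ge⟩
  have hcl : (v, (0 : ℝ)) ∈ closure C := by
    by_contra hcon
    obtain ⟨ℓ, u, h1, h2⟩ := geometric_hahn_banach_closed_point hC.closure isClosed_closure hcon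
    obtain ⟨x, α, hx⟩ := hB.flip.exists_right_prod ℓ
    simp only [LinearMap.flip_apply] at hx
    have h1' : ∀ p ∈ C, ℓ p < u := fun p hp => h1 p (subset_closure hp)
    have hle : ∀ p ∈ C, ℓ p ≤ 0 := by
      intro p hp
      by_contra! hpos
      have h3 := h1' _ (hsmul p hp ((|u| + 1) / ℓ p) (by positivity))
      rw [map_smul, smul_eq_mul, div_mul_cancel₀ _ hpos.ne'] at h3
      linarith [le_abs_self u]
    have hu : 0 ≤ u := by
      by_contra! hneg
      obtain ⟨p, hp⟩ := hne
      have h3 := h1' p hp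
      have h5 : ℓ p < 0 := h3.trans hneg
      have h4 := h1' _ (hsmul p hp (u / (2 * ℓ p)) (div_pos_of_neg_of_neg hneg (by linarith)))
      rw [map_smul, smul_eq_mul] at h4
      have h6 : u / (2 * ℓ p) * ℓ p = u / 2 := by
        have := h5.ne
        generalize ℓ p = w at *
        field_simp
      linarith
    have hxv : 0 < B x v := by
      rw [hx] at h2
      linarith
    have hα : α ≤ 0 := by
      by_contra! hpos
      obtain ⟨⟨z, ρ⟩, μ, hμ, hp⟩ := hne
      have hpos' : 0 < (|B x z + ρ * α| + 1) / α := by positivity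
      have h3 := hle (z, ρ + (|B x z + ρ * α| + 1) / α) ⟨μ, hμ, fun x s hs => by
        have := hp x s hs
        dsimp only at this ⊢
        linarith⟩
      rw [hx, add_mul, div_mul_cancel₀ _ hpos.ne'] at h3
      linarith [neg_abs_le (B x z + ρ * α)]
    rcases hα.lt_or_eq with hα | rfl
    -- Each affine minorant `B · y - c` of `f` gives a point of `C`, where the functional is
    -- nonpositive. This bounds every minorant by `a` at `x₀ + (-α)⁻¹ • x`, hence also `f` there.
    · have hα' : 0 < -α := by linarith
      have h3 : f (x₀ + (-α)⁻¹ • x) ≤ f x₀ := by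
        rw [hx₀]
        by_contra hcon
        obtain ⟨y, c, hc, hlt⟩ := exists_affine_of_not_le hB hf hcon
        have h4 := hle _ (hmemC y c hc)
        rw [hx] at h4
        simp only [map_add, map_smul, LinearMap.add_apply, LinearMap.smul_apply, smul_eq_mul]
          at hlt
        have h5 : (c - B x₀ y + a) < (-α)⁻¹ * B x y := by linarith
        rw [lt_inv_mul_iff₀ hα'] at h5
        linarith
      have h6 := hv _ h3
      simp only [add_sub_cancel_left, map_smul, LinearMap.smul_apply, smul_eq_mul] at h6
      have : 0 < (-α)⁻¹ * B x v := by positivity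
      linarith
    -- Here `B x y ≤ 0` on the domain of the conjugate, so `x` is a direction along which `f` does
    -- not increase.
    · have h3 : f (x₀ + x) ≤ f x₀ := by
        rw [hx₀]
        by_contra hcon
        obtain ⟨y, c, hc, hlt⟩ := exists_affine_of_not_le hB hf hcon
        have h4 := hle _ (hmemC y c hc)
        rw [hx] at h4
        simp only [map_add, LinearMap.add_apply] at hlt
        have h5 := (conj_le_iff hf.ne_bot y c).1 hc x₀ a hx₀.le
        linarith
      have h6 := hv _ h3
      simp only [add_sub_cancel_left] at h6
      linarith
  have hN : {p : Y × ℝ | p.1 - v ∈ W ∧ p.2 < η} ∈ 𝓝 (v, (0 : ℝ)) := by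
    have c1 : ContinuousAt (fun p : Y × ℝ => p.1 - v) (v, 0) := by fun_prop
    have c2 : ContinuousAt (fun p : Y × ℝ => p.2) (v, 0) := by fun_prop
    exact inter_mem (c1.preimage_mem_nhds (by simpa using hW))
      (c2.preimage_mem_nhds (Iio_mem_nhds hη))
  obtain ⟨⟨z, ρ⟩, ⟨hz, hρ⟩, μ, hμ, hp⟩ := mem_closure_iff_nhds.1 hcl _ hN
  dsimp only at hz hρ hp
  refine ⟨μ, μ⁻¹ • z, μ⁻¹ * ρ, hμ, ?_, ?_, ?_, fun u s hs => ?_⟩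
  · have := hp x₀ a hx₀.le
    simp only [sub_self, map_zero, LinearMap.zero_apply, mul_zero, zero_add] at this
    positivity
  · rwa [mul_inv_cancel_left₀ hμ.ne']
  · rwa [smul_inv_smul₀ hμ.ne']
  · have := hp u s hs
    rw [map_smul, smul_eq_mul, inv_mul_le_iff₀ hμ, mul_add, mul_inv_cancel_left₀ hμ.ne']
    exact this

end Conjugate

theorem eq_zero_of_forall_smul_lt {a u : ℝ} (h : ∀ t : ℝ, t * a < u) : a = 0 := by
  by_contra hne
  have := h (u / a)
  rw [div_mul_cancel₀ _ hne] at this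
  exact lt_irrefl _ this

theorem nonneg_of_forall_le_mul {a c : ℝ} (h : ∀ t : ℝ, 0 ≤ t → c ≤ t * a) : 0 ≤ a := by
  by_contra! hneg
  have := h ((|c| + 1) / (-a)) (div_nonneg (by positivity) (by linarith))
  rw [div_mul_eq_mul_div, div_neg, mul_div_cancel_right₀ _ hneg.ne] at this
  linarith [neg_abs_le c]

theorem weakDiscs.absConvex {X Y : Type*} [AddCommGroup X] [Module ℝ X] [AddCommGroup Y]
    [Module ℝ Y] {B : X →ₗ[ℝ] Y →ₗ[ℝ] ℝ} {K : Set X} (hK : K ∈ weakDiscs B) : AbsConvex ℝ K :=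
  ⟨hK.2.1, hK.1⟩

/-! ### Brøndsted-Rockafellar with a weakly compact disc. -/

section Core

variable {E F : Type*} [AddCommGroup E] [Module ℝ E] [AddCommGroup F] [Module ℝ F]
  {B : E →ₗ[ℝ] F →ₗ[ℝ] ℝ}

/-- The minimised function is `f - g₀` plus `δ` times the gauge of `K`, written in the variables
`(t, k)` so that it is lower semicontinuous on a compact product. Beyond `t = ε / δ` the penalty
exceeds the possible gain `ε`, so the minimum over `[0, ε / δ]` is global. -/
theorem exists_min_add_gauge {f : E → EReal} (hbot : ∀ x, f x ≠ ⊥)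
    (hlsc : @LowerSemicontinuous _ _ (weakTopology B) _ f) {e₀ : E} {a₀ : ℝ} (he₀ : f e₀ = a₀)
    {g₀ : F} {ε : ℝ} (hε : 0 ≤ ε) (hsub : ∀ u (s : ℝ), f u ≤ s → B (u - e₀) g₀ ≤ s - a₀ + ε)
    {δ : ℝ} (hδ : 0 < δ) {K : Set E} (hK : K ∈ weakDiscs B) (hK0 : K.Nonempty) :
    ∃ (t' : ℝ) (k' : E) (a' : ℝ), 0 ≤ t' ∧ t' ≤ ε / δ ∧ k' ∈ K ∧ f (e₀ + t' • k') = a' ∧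
      ∀ t : ℝ, 0 ≤ t → ∀ k ∈ K, ∀ s : ℝ, f (e₀ + t • k) ≤ s →
        a' - t' * B k' g₀ + δ * t' ≤ s - t * B k g₀ + δ * t := by
  let := weakTopology B
  have := weak_isTopologicalAddGroup B
  have := weak_continuousSMul B
  have hcB : Continuous fun x => B x g₀ := weak_continuous_apply B g₀
  let h : ℝ × E → EReal := fun p =>
    f (e₀ + p.1 • p.2) + ((δ * p.1 - p.1 * B p.2 g₀ : ℝ) : EReal)
  have hh : LowerSemicontinuous h := by
    refine LowerSemicontinuous.add' (hlsc.comp (by fun_prop))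
      (Continuous.lowerSemicontinuous (continuous_coe_real_ereal.comp ?_)) ?_
    · have : Continuous fun p : ℝ × E => B p.2 g₀ := hcB.comp continuous_snd
      fun_prop
    · intro p
      exact EReal.continuousAt_add (Or.inr (EReal.coe_ne_bot _)) (Or.inr (EReal.coe_ne_top _))
  obtain ⟨k₀, hk₀⟩ := hK0
  have hT : 0 ≤ ε / δ := by positivity
  obtain ⟨⟨t', k'⟩, ⟨ht', hk'⟩, hmin⟩ := LowerSemicontinuousOn.exists_isMinOn
    (s := Set.Icc 0 (ε / δ) ×ˢ K) ⟨(0, k₀), ⟨le_rfl, hT⟩, hk₀⟩ (isCompact_Icc.prod hK.2.2)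
    (hh.lowerSemicontinuousOn _)
  have hval : h (t', k') ≤ a₀ := by
    have := hmin (show (0, k₀) ∈ Set.Icc 0 (ε / δ) ×ˢ K from ⟨⟨le_rfl, hT⟩, hk₀⟩)
    simpa [h, he₀] using this
  have hfin : f (e₀ + t' • k') ≠ ⊤ := by
    intro htop
    simp only [h, htop, EReal.top_add_coe, top_le_iff] at hval
    exact EReal.coe_ne_top _ hval
  have hfa : f (e₀ + t' • k') = ((f (e₀ + t' • k')).toReal : EReal) :=
    (EReal.coe_toReal hfin (hbot _)).symm
  set a' := (f (e₀ + t' • k')).toReal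
  have hval' : h (t', k') = ((a' - t' * B k' g₀ + δ * t' : ℝ) : EReal) := by
    simp only [h, hfa, ← EReal.coe_add]
    congr 1
    ring
  refine ⟨t', k', a', ht'.1, ht'.2, hk', hfa, fun t ht k hk s hs => ?_⟩
  by_cases htT : t ≤ ε / δ
  · have h1 : h (t', k') ≤ h (t, k) := hmin (show (t, k) ∈ Set.Icc 0 (ε / δ) ×ˢ K from
      ⟨⟨ht, htT⟩, hk⟩)
    have h2 : h (t, k) ≤ ((s - t * B k g₀ + δ * t : ℝ) : EReal) := by
      have : s - t * B k g₀ + δ * t = s + (δ * t - t * B k g₀) := by ring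
      rw [this, EReal.coe_add]
      exact add_le_add_left hs _
    have h3 := h1.trans h2
    rwa [hval', EReal.coe_le_coe_iff] at h3
  · push Not at htT
    rw [hval', EReal.coe_le_coe_iff] at hval
    have h1 := hsub _ s hs
    simp only [add_sub_cancel_left, map_smul, LinearMap.smul_apply, smul_eq_mul] at h1
    rw [div_lt_iff₀ hδ] at htT
    linarith

variable [TopologicalSpace E] [TopologicalSpace F]

theorem isClosed_of_weakDisc (hB : IsDualPair B) {K : Set E} (hK : K ∈ weakDiscs B) :
    IsClosed K := by
  have hcl : @IsClosed E (weakTopology B) K :=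
    @IsCompact.isClosed E (weakTopology B) (weak_t2Space B hB.separatingLeft) K hK.2.2
  have hid : Continuous[_, weakTopology B] (id : E → E) :=
    continuous_induced_rng.2 (continuous_pi fun y => hB.continuous_apply_left y)
  exact @IsClosed.preimage E E _ (weakTopology B) id hid K hcl

variable [IsTopologicalAddGroup E] [ContinuousSMul ℝ E] [LocallyConvexSpace ℝ E]
  [IsTopologicalAddGroup F] [ContinuousSMul ℝ F] [LocallyConvexSpace ℝ F]

/-- The polar of `K ∩ M` is the closure of the sum of the polar of `K` and of `M^⊥`. -/
theorem exists_decomposition (hB : IsDualPair B) {M : Submodule ℝ E} (hM : IsClosed (M : Set E))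
    {K : Set E} (hK : K ∈ weakDiscs B) (hK0 : K.Nonempty) {δ : ℝ} (hδ : 0 < δ) {z : F}
    (hz : ∀ k ∈ K, k ∈ M → |B k z| ≤ δ) {N : Set F} (hN : N ∈ 𝓝 (0 : F)) :
    ∃ m κ : F, (∀ x ∈ M, B x m = 0) ∧ κ ∈ B.polar K ∧ z - m - δ • κ ∈ N := by
  let Q : Set F := {q | ∃ m κ : F, (∀ x ∈ M, B x m = 0) ∧ κ ∈ B.polar K ∧ q = m + δ • κ}
  have hpol : AbsConvex ℝ (B.polar K) := LinearMap.polar_AbsConvex K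
  have hQ : Convex ℝ Q := by
    rintro _ ⟨m₁, κ₁, hm₁, hκ₁, rfl⟩ _ ⟨m₂, κ₂, hm₂, hκ₂, rfl⟩ a b ha hb hab
    refine ⟨a • m₁ + b • m₂, a • κ₁ + b • κ₂, fun x hx => ?_, hpol.2 hκ₁ hκ₂ ha hb hab, ?_⟩
    · simp [hm₁ x hx, hm₂ x hx]
    · module
  suffices hcl : z ∈ closure Q by
    have hN' : {q | z - q ∈ N} ∈ 𝓝 z := by
      have : ContinuousAt (fun q : F => z - q) z := by fun_prop
      exact this.preimage_mem_nhds (by simpa using hN)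
    obtain ⟨_, hq, m, κ, hm, hκ, rfl⟩ := mem_closure_iff_nhds.1 hcl _ hN'
    exact ⟨m, κ, hm, hκ, by simpa [sub_sub] using hq⟩
  by_contra hcon
  obtain ⟨ℓ, u, h1, h2⟩ := geometric_hahn_banach_closed_point hQ.closure isClosed_closure hcon
  obtain ⟨v, hv⟩ := hB.flip.exists_right ℓ
  simp only [LinearMap.flip_apply] at hv
  have h1' : ∀ m κ : F, (∀ x ∈ M, B x m = 0) → κ ∈ B.polar K → B v m + δ * B v κ < u := by
    intro m κ hm hκ
    have := h1 _ (subset_closure ⟨m, κ, hm, hκ, rfl⟩)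
    rw [hv] at this
    simpa using this
  have hzero : (0 : F) ∈ B.polar K := B.zero_mem_polar K
  have hu : 0 < u := by simpa using h1' 0 0 (by simp) hzero
  -- The functional is bounded above on the subspace `M^⊥`, hence zero on it, and `M` is closed.
  have hvM : v ∈ M := by
    by_contra hvM
    obtain ⟨φ, w, h3, h4⟩ := geometric_hahn_banach_closed_point M.convex hM hvM
    obtain ⟨g, hg⟩ := hB.exists_right φ
    have hgM : ∀ x ∈ M, B x g = 0 := by
      intro x hx
      refine eq_zero_of_forall_smul_lt (u := w) fun t => ?_
      have := h3 _ (M.smul_mem t hx)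
      rw [hg] at this
      simpa using this
    have h5 : B v g = 0 := by
      refine eq_zero_of_forall_smul_lt (u := u) fun t => ?_
      have := h1' (t • g) 0 (fun x hx => by simp [hgM x hx]) hzero
      simpa using this
    have h6 := h3 0 M.zero_mem
    rw [hg, h5] at h4
    simp only [map_zero] at h6
    linarith
  -- It is also bounded by `u` on `δ • B.polar K`, so the bipolar theorem applies. The bound `hz` at
  -- this point then contradicts `u < B v z`.
  have hvK : (δ / u) • v ∈ K := by
    refine bipolar_subset hB (weakDiscs.absConvex hK) (isClosed_of_weakDisc hB hK) hK0 ?_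
    intro κ hκ
    have h3 := h1' 0 κ (by simp) hκ
    have h4 := h1' 0 (-κ) (by simp) (hpol.1.neg_mem_iff.2 hκ)
    simp only [map_zero, zero_add, map_neg] at h3 h4
    rw [LinearMap.flip_apply, map_smul, LinearMap.smul_apply, smul_eq_mul, Real.norm_eq_abs,
      div_mul_eq_mul_div, abs_div, abs_of_pos hu, div_le_one hu, abs_le]
    constructor <;> linarith
  have h3 := hz _ hvK (M.smul_mem _ hvM)
  rw [map_smul, LinearMap.smul_apply, smul_eq_mul, abs_mul, abs_of_pos (by positivity),
    div_mul_eq_mul_div, div_le_iff₀ hu, mul_le_mul_iff_right₀ hδ] at h3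
  rw [hv] at h2
  linarith [le_abs_self (B v z)]

/-- A Brøndsted-Rockafellar type theorem: if `g₀` is an `ε`-subgradient of `f` at `e₀`, and `f` is
continuous at `e₁` relatively to the closed affine hull of its domain, then there are exact
subgradients of `f` with controlled distance to `(e₀, g₀)`. -/
theorem exists_subdiff_of_approx (hB : IsDualPair B) {f : E → EReal} (hbot : ∀ x, f x ≠ ⊥)
    (hconv : Convex ℝ (epi f)) (hlsc : @LowerSemicontinuous _ _ (weakTopology B) _ f)
    (hL : IsClosed (affineSpan ℝ (dom f) : Set E)) {e₁ : E} (he₁ : e₁ ∈ dom f)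
    (hcont : ContinuousWithinAt f (affineSpan ℝ (dom f) : Set E) e₁)
    {e₀ : E} {a₀ : ℝ} (he₀ : f e₀ = a₀)
    {g₀ : F} {ε : ℝ} (hε : 0 ≤ ε) (hsub : ∀ u (s : ℝ), f u ≤ s → B (u - e₀) g₀ ≤ s - a₀ + ε)
    {δ : ℝ} (hδ : 0 < δ) {K : Set E} (hK : K ∈ weakDiscs B) {σ : ℝ} (hσ : 0 < σ)
    (hσK : σ • (e₁ - e₀) ∈ K) :
    ∃ (t : ℝ) (k : E), 0 ≤ t ∧ t ≤ ε / δ ∧ k ∈ K ∧ ∀ N ∈ 𝓝 (0 : F),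
      ∃ g κ : F, g ∈ subdiff B f (e₀ + t • k) ∧ κ ∈ B.polar K ∧ g - g₀ - δ • κ ∈ N := by
  have hK0 : K.Nonempty := ⟨_, hσK⟩
  obtain ⟨t', k', a', ht', ht'T, hk', hfa, hmin⟩ :=
    exists_min_add_gauge hbot hlsc he₀ hε hsub hδ hK hK0
  refine ⟨t', k', ht', ht'T, hk', fun N hN => ?_⟩
  set c : ℝ := a' - t' * B k' g₀ + δ * t' with hc
  let L := affineSpan ℝ (dom f)
  let M := L.direction
  have hdomL : ∀ x (s : ℝ), f x ≤ s → x ∈ L := fun x s hs =>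
    subset_affineSpan ℝ _ (hs.trans_lt (EReal.coe_lt_top s))
  have he₀L : e₀ ∈ L := hdomL _ _ he₀.le
  have hML : ∀ v : E, v ∈ M ↔ e₀ + v ∈ L := fun v => by
    rw [add_comm, ← vadd_eq_add, AffineSubspace.vadd_mem_iff_mem_direction v he₀L]
  have hM : IsClosed (M : Set E) := by
    have : (M : Set E) = (fun v => e₀ + v) ⁻¹' (L : Set E) := by
      ext v
      exact hML v
    rw [this]
    exact hL.preimage (by fun_prop)
  have he₁L : e₁ ∈ L := subset_affineSpan ℝ _ he₁
  have he₁' : f e₁ = ((f e₁).toReal : EReal) := (EReal.coe_toReal he₁.ne (hbot e₁)).symm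
  set a₁ := (f e₁).toReal
  have hv₁M : e₁ - e₀ ∈ M := by
    rw [hML]; simpa using he₁L
  let v₁ : M := ⟨e₁ - e₀, hv₁M⟩
  -- Minimality says that the epigraph of `f (e₀ + ·)` misses the strict hypograph of the concave
  -- function `c + g₀ - δ * gauge`. Working in the direction space `M` lets relative continuity of
  -- `f` give the epigraph interior points.
  let C₁ : Set (M × ℝ) := {p | f (e₀ + p.1) ≤ p.2}
  let C₂ : Set (M × ℝ) := {p | ∃ t : ℝ, 0 ≤ t ∧ ∃ k ∈ K, (p.1 : E) = t • k ∧
    p.2 < c + B p.1 g₀ - δ * t}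
  have hC₁ : Convex ℝ C₁ := by
    intro p hp q hq a b ha hb hab
    have h1 := hconv (show (e₀ + (p.1 : E), p.2) ∈ epi f from hp)
      (show (e₀ + (q.1 : E), q.2) ∈ epi f from hq) ha hb hab
    have h2 : e₀ + ((a • p + b • q).1 : E) = a • (e₀ + (p.1 : E)) + b • (e₀ + (q.1 : E)) := by
      obtain rfl : b = 1 - a := by linarith
      simp only [Prod.fst_add, Prod.smul_fst, Submodule.coe_add, Submodule.coe_smul]
      module
    change f (e₀ + ((a • p + b • q).1 : E)) ≤ _
    rw [h2]
    exact h1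
  have hC₂ : Convex ℝ C₂ := by
    rintro p ⟨t, ht, k, hk, hpk, hp⟩ q ⟨s, hs, l, hl, hql, hq⟩ a b ha hb hab
    have h0 : (a • p + b • q).2 <
        c + B ((a • p + b • q).1 : E) g₀ - δ * (a * t + b * s) := by
      simp only [Prod.fst_add, Prod.smul_fst, Submodule.coe_add, Submodule.coe_smul,
        Prod.snd_add, Prod.smul_snd, smul_eq_mul, map_add, map_smul, LinearMap.add_apply,
        LinearMap.smul_apply]
      have e : c = a * c + b * c := by rw [← add_mul, hab, one_mul]
      rw [e]
      rcases ha.eq_or_lt with rfl | ha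
      · obtain rfl : b = 1 := by linarith
        linarith
      · have h1 := mul_lt_mul_of_pos_left hp ha
        have h2 := mul_le_mul_of_nonneg_left hq.le hb
        linarith
    have hnn : 0 ≤ a * t + b * s := by positivity
    refine ⟨a * t + b * s, hnn, ?_⟩
    have hcoe : ((a • p + b • q).1 : E) = (a * t) • k + (b * s) • l := by
      simp [hpk, hql, mul_smul]
    rcases hnn.eq_or_lt with h1 | h1
    · have h2 : a * t = 0 := by nlinarith [mul_nonneg ha ht, mul_nonneg hb hs]
      have h3 : b * s = 0 := by nlinarith [mul_nonneg ha ht, mul_nonneg hb hs]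
      exact ⟨k, hk, by rw [hcoe, h2, h3]; simp, h0⟩
    · refine ⟨((a * t) / (a * t + b * s)) • k + ((b * s) / (a * t + b * s)) • l,
        hK.1 hk hl (by positivity) (by positivity) (by rw [← add_div, div_self h1.ne']), ?_, h0⟩
      rw [hcoe, smul_add, smul_smul, smul_smul, mul_div_cancel₀ _ h1.ne',
        mul_div_cancel₀ _ h1.ne']
  have hdisj : Disjoint C₁ C₂ := by
    rw [Set.disjoint_left]
    rintro p hp ⟨t, ht, k, hk, hpk, hlt⟩
    have hp' : f (e₀ + t • k) ≤ p.2 := by rw [← hpk]; exact hp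
    have := hmin t ht k hk p.2 hp'
    rw [hpk] at hlt
    simp only [map_smul, LinearMap.smul_apply, smul_eq_mul] at hlt
    linarith
  have hint : (v₁, a₁ + 2) ∈ interior C₁ := by
    rw [mem_interior_iff_mem_nhds]
    have h1 : ∀ᶠ x in 𝓝[(L : Set E)] e₁, f x < ((a₁ + 1 : ℝ) : EReal) := by
      refine hcont.eventually_lt_const ?_
      rw [he₁', EReal.coe_lt_coe_iff]
      linarith
    have h2 : Tendsto (fun v : M => e₀ + (v : E)) (𝓝 v₁) (𝓝[(L : Set E)] e₁) := by
      refine tendsto_nhdsWithin_iff.2 ⟨?_, Eventually.of_forall fun v => (hML v).1 v.2⟩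
      have : ContinuousAt (fun v : M => e₀ + (v : E)) v₁ := by fun_prop
      have h3 := this.tendsto
      simpa [v₁] using h3
    have h3 := h2.eventually h1
    have h4 : ∀ᶠ r : ℝ in 𝓝 (a₁ + 2), a₁ + 1 < r := Ioi_mem_nhds (by linarith)
    filter_upwards [h3.prod_nhds h4] with p hp
    exact hp.1.le.trans (EReal.coe_le_coe_iff.2 hp.2.le)
  obtain ⟨ℓ, u, h1, h2⟩ := geometric_hahn_banach_open hC₁.interior isOpen_interior hC₂
    (hdisj.mono_left interior_subset)
  have h1' : ∀ p ∈ C₁, ℓ p ≤ u := by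
    intro p hp
    refine closure_minimal (fun x hx => (h1 x hx).le) (isClosed_Iic.preimage ℓ.continuous) ?_
    rw [hC₁.closure_interior_eq_closure_of_nonempty_interior ⟨_, hint⟩]
    exact subset_closure hp
  -- The Hahn-Banach extension fixes `g` only modulo `M^⊥`.
  obtain ⟨φ, hφ⟩ := StrongDual.exists_extension M (ℓ.comp (ContinuousLinearMap.inl ℝ M ℝ))
  obtain ⟨g, hg⟩ := hB.exists_right φ
  set α := ℓ (0, 1)
  have hℓ : ∀ (v : M) (s : ℝ), ℓ (v, s) = B v g + s * α := by
    intro v s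
    have h3 : (v, s) = (v, (0 : ℝ)) + s • ((0 : M), (1 : ℝ)) := by simp
    rw [h3, map_add, map_smul, smul_eq_mul, ← hg, hφ]
    simp [α]
  -- Since a positive multiple of `e₁ - e₀` lies in `K`, the set `C₂` has a point below the interior
  -- point `(v₁, a₁ + 2)`, which excludes a vertical hyperplane.
  have hα : α < 0 := by
    have hσ' : e₁ - e₀ = σ⁻¹ • σ • (e₁ - e₀) := by rw [inv_smul_smul₀ hσ.ne']
    let r := min (c + B (e₁ - e₀) g₀ - δ * σ⁻¹ - 1) a₁
    have h3 := h2 (v₁, r) ⟨σ⁻¹, by positivity, _, hσK, hσ', by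
      have : r ≤ c + B (e₁ - e₀) g₀ - δ * σ⁻¹ - 1 := min_le_left _ _
      have : r < c + B (e₁ - e₀) g₀ - δ * σ⁻¹ := by linarith
      exact this⟩
    have h4 := h1 _ hint
    rw [hℓ] at h3 h4
    have h5 : r ≤ a₁ := min_le_right _ _
    nlinarith
  have hα' : 0 < -α := by linarith
  set g₁ : F := (-α)⁻¹ • g with hg₁
  set w : ℝ := (-α)⁻¹ * u
  have H1 : ∀ v ∈ M, ∀ s : ℝ, f (e₀ + v) ≤ s → B v g₁ - s ≤ w := by
    intro v hv s hs
    have := h1' (⟨v, hv⟩, s) hs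
    rw [hℓ] at this
    rw [hg₁, map_smul, smul_eq_mul, sub_le_iff_le_add, inv_mul_le_iff₀ hα', mul_add,
      mul_inv_cancel_left₀ hα'.ne']
    dsimp only at this
    linarith
  have H2 : ∀ t : ℝ, 0 ≤ t → ∀ k ∈ K, t • k ∈ M →
      w ≤ t * B k g₁ - (c + t * B k g₀ - δ * t) := by
    intro t ht k hk hkM
    have key : ∀ r < c + t * B k g₀ - δ * t, r ≤ t * B k g₁ - w := by
      intro r hr
      have h3 := h2 (⟨t • k, hkM⟩, r) ⟨t, ht, k, hk, rfl, by simpa using hr⟩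
      rw [hℓ] at h3
      simp only [map_smul, LinearMap.smul_apply, smul_eq_mul] at h3
      have h4 : w ≤ t * B k g₁ - r := by
        have h5 : t * B k g₁ = (-α)⁻¹ * (t * B k g) := by
          rw [hg₁, map_smul, smul_eq_mul]; ring
        rw [h5, le_sub_iff_add_le, ← le_sub_iff_add_le', ← sub_nonneg]
        have h6 : (-α)⁻¹ * (t * B k g) - w - r = (-α)⁻¹ * (t * B k g + r * α - u) := by
          have : r = (-α)⁻¹ * (-α) * r := by rw [inv_mul_cancel₀ hα'.ne', one_mul]
          nth_rewrite 1 [this]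
          ring
        rw [h6]
        exact mul_nonneg (inv_nonneg.2 hα'.le) (by linarith)
      linarith
    have := le_of_forall_lt_imp_le_of_dense key
    linarith
  have hv'M : t' • k' ∈ M := (hML _).2 (hdomL _ _ hfa.le)
  have H3 : w = t' * B k' g₁ - a' := by
    have h3 := H1 _ hv'M a' hfa.le
    have h4 := H2 t' ht' k' hk' hv'M
    simp only [map_smul, LinearMap.smul_apply, smul_eq_mul] at h3
    linarith
  -- Let `t` tend to infinity in `H2`. Symmetry of `K` then gives `|B k (g₁ - g₀)| ≤ δ` on `K ∩ M`.
  have hbound : ∀ k ∈ K, k ∈ M → 0 ≤ B k (g₁ - g₀) + δ := by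
    intro k hk hkM
    refine nonneg_of_forall_le_mul (c := c + w) fun t ht => ?_
    have := H2 t ht k hk (M.smul_mem t hkM)
    rw [map_sub]
    linarith
  obtain ⟨m, κ, hm, hκ, hN'⟩ := exists_decomposition hB hM hK hK0 hδ (z := g₁ - g₀)
    (fun k hk hkM => by
      have h3 := hbound k hk hkM
      have h4 := hbound (-k) (hK.2.1.neg_mem_iff.2 hk) (M.neg_mem hkM)
      rw [map_neg, LinearMap.neg_apply] at h4
      rw [abs_le]
      constructor <;> linarith) hN
  -- Subtracting `m ∈ M^⊥` keeps the subgradient property, because the domain lies in `e₀ + M`.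
  refine ⟨g₁ - m, κ, (mem_subdiff_iff hbot hfa _).2 fun x s hs => ?_, hκ, ?_⟩
  · have hxM : x - e₀ ∈ M := (hML _).2 (by simpa using hdomL x s hs)
    have h3 := H1 _ hxM s (by simpa using hs)
    have h4 := hm _ (M.sub_mem hxM hv'M)
    have h5 : x - (e₀ + t' • k') = x - e₀ - t' • k' := by abel
    rw [h5, map_sub (B _), h4]
    rw [map_sub B, LinearMap.sub_apply, map_smul B, LinearMap.smul_apply, smul_eq_mul]
    linarith
  · convert hN' using 1
    abel

end Core

/-! ### Reference points, upper limits and enlarged discs. -/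

theorem FiniteContinuousOnRelInterior.exists_point {E : Type*} [AddCommGroup E] [Module ℝ E]
    [t : TopologicalSpace E] {f : E → EReal} (h : FiniteContinuousOnRelInterior t f) :
    IsClosed (affineSpan ℝ (dom f) : Set E) ∧ ∃ e ∈ dom f,
      ContinuousWithinAt f (affineSpan ℝ (dom f) : Set E) e := by
  obtain ⟨⟨e, he⟩, hc⟩ := h
  have hcont := (hc e he).2.2
  unfold relInterior at he
  split_ifs at he with hcl
  · exact ⟨hcl, e, intrinsicInterior_subset he, hcont⟩
  · exact absurd he (Set.notMem_empty e)

theorem upperLimit_mono {U V : Type*} [TopologicalSpace V] {F G : Filter U} (h : F ≤ G)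
    (M : U → Set V) : upperLimit F M ⊆ upperLimit G M :=
  fun _ hv W hW Z hZ => hv W hW Z (h hZ)

section Segment

variable {X Y : Type*} [AddCommGroup X] [Module ℝ X] [AddCommGroup Y] [Module ℝ Y]
  {B : X →ₗ[ℝ] Y →ₗ[ℝ] ℝ}

/-- Adding a segment forces a chosen vector into the disc: one towards the continuity point, or one
on which the polar must be bounded. -/
theorem add_segment_mem_weakDiscs {K : Set X} (hK : K ∈ weakDiscs B) (d : X) :
    K + (fun t : ℝ => t • d) '' Set.Icc (-1) 1 ∈ weakDiscs B :=
  add_mem_weakDiscs hK (segment_mem_weakDiscs B d)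

theorem subset_add_segment (K : Set X) (d : X) :
    K ⊆ K + (fun t : ℝ => t • d) '' Set.Icc (-1) 1 := fun k hk =>
  ⟨k, hk, 0, ⟨0, by simp, zero_smul _ _⟩, add_zero k⟩

theorem mem_add_segment {K : Set X} (hK : (0 : X) ∈ K) (d : X) :
    d ∈ K + (fun t : ℝ => t • d) '' Set.Icc (-1) 1 :=
  ⟨0, hK, d, ⟨1, by simp, one_smul _ _⟩, zero_add d⟩

end Segment

/-! ### The two inclusions and the two continuity cases. -/

section Final

variable {X Y : Type*} [AddCommGroup X] [Module ℝ X] [TopologicalSpace X]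
  [AddCommGroup Y] [Module ℝ Y] [TopologicalSpace Y] {B : X →ₗ[ℝ] Y →ₗ[ℝ] ℝ}

theorem polar_mem_weakDiscs [IsTopologicalAddGroup Y] [ContinuousSMul ℝ Y] (hB : IsDualPair B)
    {V : Set Y} (hV : V ∈ 𝓝 (0 : Y)) : B.flip.polar V ∈ weakDiscs B := by
  have h : AbsConvex ℝ (B.flip.polar V) := LinearMap.polar_AbsConvex V
  exact ⟨h.2, h.1, isCompact_polar_of_mem_nhds hB hV⟩

/-- If `y` is an approximate subgradient of `f` at `x₀` with `μ • y` close to `v`, then there are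
exact subgradients `y'` of `f` at points `x` near `x₀`, with `μ • y'` close to `v`. -/
def HasExactApproximations (B : X →ₗ[ℝ] Y →ₗ[ℝ] ℝ) (f : X → EReal) (x₀ : X) (a : ℝ) : Prop :=
  ∀ U ∈ 𝓝 (0 : X), ∀ W ∈ 𝓝 (0 : Y), ∀ (v : Y) (ρ : ℝ), 0 < ρ →
    ∃ W' ∈ 𝓝 (0 : Y), ∃ η : ℝ, 0 < η ∧ ∀ (μ ε : ℝ) (y : Y), 0 < μ → 0 ≤ ε → μ * ε < η →
      μ • y - v ∈ W' → (∀ u (s : ℝ), f u ≤ s → B (u - x₀) y ≤ s - a + ε) →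
      ∃ (x : X) (y' : Y), y' ∈ subdiff B f x ∧ x - x₀ ∈ U ∧ μ • y' - v ∈ W ∧
        |μ * B (x - x₀) y| < ρ ∧ |μ * B (x - x₀) (y' - y)| < ρ

/-- Split `x - x₀` as `(x - u) + (u - x₀)`: `μ` times the subgradient inequality at `u` bounds the
first part by `μ * (a - f u)`, and both bounds tend to zero. -/
theorem upperLimit_subset_normalCone (hB : IsDualPair B) {f : X → EReal} (hbot : ∀ x, f x ≠ ⊥)
    {x₀ : X} {a : ℝ} (hx₀ : f x₀ = a) :
    upperLimit (valueFilter B f x₀) (scaledSubdiff B f) ⊆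
      normalCone B (sublevel f (f x₀)) x₀ := by
  intro v hv x hx
  by_contra! hpos
  set ρ := B (x - x₀) v with hρ
  have hW : {w : Y | ρ / 2 < B (x - x₀) w} ∈ 𝓝 v :=
    (hB.continuous_apply_right (x - x₀)).continuousAt.eventually_const_lt (by linarith)
  have hball : Metric.ball (0 : ℝ) (ρ / 4) ∈ 𝓝 (0 : ℝ) := Metric.ball_mem_nhds _ (by positivity)
  obtain ⟨⟨u, μ, y⟩, ⟨⟨hμ, hval⟩, hB'⟩, _, ⟨hy, rfl⟩, hw⟩ := hv _ hW _
    (inter_mem_inf (inter_mem_inf (mem_principal_self _) (preimage_mem_comap hball))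
      (preimage_mem_comap hball))
  simp only [Set.mem_preimage, mem_ball_zero_iff, Real.norm_eq_abs, abs_lt, hx₀,
    EReal.toReal_coe] at hval hB'
  change 0 ≤ μ at hμ
  change ρ / 2 < B (x - x₀) (μ • y) at hw
  have hu : f u = ((f u).toReal : EReal) := (EReal.coe_toReal hy.1.ne (hbot u)).symm
  have h1 := mul_le_mul_of_nonneg_left ((mem_subdiff_iff hbot hu y).1 hy x a (hx.trans hx₀.le)) hμ
  have h2 : B (x - x₀) (μ • y) = μ * B (x - u) y + μ * B (u - x₀) y := by
    simp only [map_sub, LinearMap.sub_apply, map_smul, smul_eq_mul]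
    ring
  linarith [hval.1, hB'.2]

variable [IsTopologicalAddGroup X] [ContinuousSMul ℝ X] [LocallyConvexSpace ℝ X]
  [IsTopologicalAddGroup Y] [ContinuousSMul ℝ Y] [LocallyConvexSpace ℝ Y]

/-- The penalty is `δ = μ⁻¹`: then `μ • (g - y)` is, up to a negligible error, in the polar of the
disc and so in `V`, while `x` moves by `t • k` with `t ≤ μ * ε`. -/
theorem hasExactApproximations_of_continuous (hB : IsDualPair B) {f : X → EReal}
    (hf : IsGammaZero f) (hcont : FiniteContinuousOnRelInterior inferInstance f) {x₀ : X} {a : ℝ}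
    (hx₀ : f x₀ = a) : HasExactApproximations B f x₀ a := by
  obtain ⟨hL, x₁, hx₁, hc₁⟩ := hcont.exists_point
  have hlsc : @LowerSemicontinuous _ _ (weakTopology B) _ f := by
    have := lowerSemicontinuous_conj (B := B.flip) (conj B f)
    rwa [conj_conj hB hf] at this
  intro U hU W hW v ρ hρ
  obtain ⟨V, hV, hVa, hVc, hVW⟩ := exists_absConvex_closed_nhds hW
  obtain ⟨U₁, hU₁, -, -, hUU⟩ := exists_absConvex_closed_nhds hU
  have hK₀ := polar_mem_weakDiscs hB hV
  set K₀ := B.flip.polar V with hK₀def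
  have h0K₀ : (0 : X) ∈ K₀ := B.flip.zero_mem_polar V
  obtain ⟨r, hr, hrU⟩ := exists_smul_mem_of_weakly_compact hB (weakDiscs.absConvex hK₀) hK₀.2.2 hU₁
  obtain ⟨c, hc, hcV⟩ := exists_pos_smul_mem hV v
  have hKv : ∀ k ∈ K₀, |B k v| ≤ 1 / c := by
    intro k hk
    have := hk _ (hcV c (abs_of_pos hc).le)
    rw [LinearMap.flip_apply, map_smul, smul_eq_mul, Real.norm_eq_abs, abs_mul, abs_of_pos hc]
      at this
    rwa [le_div_iff₀ hc, mul_comm]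
  -- In the bound `1 / c + 2` for `|B k (μ • y)|`, the parts come from `v`, from `μ • y - v ∈ V` and
  -- from the added segment.
  refine ⟨V, hV, min (min r 1) (min (ρ / (1 / c + 2)) (ρ / 2)), by positivity, ?_⟩
  intro μ ε y hμ hε hη hyv hsub
  rw [lt_min_iff, lt_min_iff, lt_min_iff] at hη
  obtain ⟨⟨hηr, hη1⟩, hηc, hηρ⟩ := hη
  set d := x₁ - x₀ with hd
  obtain ⟨c₂, hc₂, hc₂U⟩ := exists_pos_smul_mem hU₁ d
  -- The segment towards `x₁` may depend on `μ` and `y`. It is short enough to stay in `U₁` and to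
  -- pair with `μ • y` by at most one.
  let s := min c₂ (1 / (1 + |B d (μ • y)|))
  have hs : 0 < s := by positivity
  have hsc : s ≤ c₂ := min_le_left _ _
  have hsd : s * |B d (μ • y)| ≤ 1 := by
    have h1 : s ≤ 1 / (1 + |B d (μ • y)|) := min_le_right _ _
    rw [le_div_iff₀ (by positivity)] at h1
    linarith
  obtain ⟨t, k, ht0, htε, hk, hN⟩ := exists_subdiff_of_approx hB hf.ne_bot hf.convex_epi hlsc hL
    hx₁ hc₁ hx₀ hε hsub (δ := μ⁻¹) (by positivity) (add_segment_mem_weakDiscs hK₀ (s • d)) hs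
    (mem_add_segment h0K₀ (s • d))
  have htμ : t ≤ μ * ε := by
    rwa [div_inv_eq_mul, mul_comm] at htε
  have hN0 : {n : Y | μ • n ∈ V ∧ |μ * B (t • k) n| < ρ / 2} ∈ 𝓝 (0 : Y) := by
    have h1 : ContinuousAt (fun n : Y => μ • n) 0 := by fun_prop
    have h2 : ContinuousAt (fun n : Y => |μ * B (t • k) n|) 0 :=
      (continuous_const.mul (hB.continuous_apply_right _)).abs.continuousAt
    exact inter_mem (h1.preimage_mem_nhds (by simpa using hV))
      (h2.eventually_lt_const (by simpa using hρ))
  obtain ⟨g, κ, hg, hκ, hnV, hnρ⟩ := hN _ hN0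
  have hBkκ : |B k κ| ≤ 1 := hκ k hk
  have hκV : κ ∈ V := by
    refine bipolar_subset hB.flip hVa hVc ⟨0, mem_of_mem_nhds hV⟩ fun k hk => ?_
    exact hκ k (subset_add_segment _ _ hk)
  obtain ⟨k₀, hk₀, _, ⟨τ, hτ, rfl⟩, rfl⟩ := hk
  have hτ' : |τ| ≤ 1 := abs_le.2 hτ
  have hky : |B (k₀ + τ • s • d) (μ • y)| ≤ 1 / c + 2 := by
    have h1 := hKv k₀ hk₀
    have h2 : |B k₀ (μ • y - v)| ≤ 1 := hk₀ _ hyv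
    have h3 : B (k₀ + τ • s • d) (μ • y) = B k₀ v + B k₀ (μ • y - v) + τ * (s * B d (μ • y)) := by
      simp only [map_add, map_sub, map_smul, LinearMap.add_apply, LinearMap.smul_apply, smul_eq_mul]
      ring
    have h4 : |τ * (s * B d (μ • y))| ≤ 1 := by
      rw [abs_mul, abs_mul, abs_of_pos hs]
      exact mul_le_one₀ hτ' (by positivity) hsd
    rw [h3]
    have h5 := abs_add_le (B k₀ v + B k₀ (μ • y - v)) (τ * (s * B d (μ • y)))
    have h6 := abs_add_le (B k₀ v) (B k₀ (μ • y - v))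
    linarith
  dsimp only at *
  set k := k₀ + τ • s • d with hkdef
  refine ⟨x₀ + t • k, g, hg, ?_, ?_, ?_, ?_⟩
  · rw [add_sub_cancel_left, hkdef, smul_add, ← add_zero (t • k₀ + _)]
    refine hUU _ (hrU t ?_ k₀ hk₀) _ ?_ _ (mem_of_mem_nhds hU₁)
    · rw [abs_of_nonneg ht0]; linarith
    · rw [smul_smul, smul_smul]
      refine hc₂U _ ?_
      rw [abs_mul, abs_mul, abs_of_nonneg ht0, abs_of_pos hs]
      have : t * |τ| ≤ 1 := mul_le_one₀ (by linarith) (abs_nonneg _) hτ'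
      calc t * |τ| * s ≤ 1 * s := by gcongr
        _ ≤ c₂ := by linarith
  · have : μ • g - v = (μ • y - v) + κ + μ • (g - y - μ⁻¹ • κ) := by
      rw [smul_sub, smul_sub, smul_inv_smul₀ hμ.ne']
      abel
    rw [this]
    exact hVW _ hyv _ hκV _ hnV
  · have h1 : μ * B (x₀ + t • k - x₀) y = t * B k (μ • y) := by
      simp only [add_sub_cancel_left, map_smul, LinearMap.smul_apply, smul_eq_mul]
      ring
    rw [h1, abs_mul, abs_of_nonneg ht0]
    have hpos : 0 < 1 / c + 2 := by positivity
    calc t * |B k (μ • y)| ≤ (μ * ε) * (1 / c + 2) := by gcongr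
      _ < ρ := by rwa [lt_div_iff₀ hpos] at hηc
  · have h1 : μ * B (x₀ + t • k - x₀) (g - y) = t * B k κ + μ * B (t • k) (g - y - μ⁻¹ • κ) := by
      simp only [add_sub_cancel_left, map_smul, LinearMap.smul_apply, smul_eq_mul, map_sub]
      field_simp
      ring
    rw [h1]
    have h2 := abs_add_le (t * B k κ) (μ * B (t • k) (g - y - μ⁻¹ • κ))
    have h3 : |t * B k κ| ≤ t := by
      rw [abs_mul, abs_of_nonneg ht0]
      exact mul_le_of_le_one_right ht0 hBkκ
    linarith

/-- The roles are exchanged: `x₀` is an `ε`-subgradient of the conjugate at `y`. Now `x` moves by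
about `δ • κ` with `δ` fixed, and `y` moves by `t • k` with `μ * t ≤ μ * ε / δ` small. -/
theorem hasExactApproximations_of_continuous_conj (hB : IsDualPair B) {f : X → EReal}
    (hf : IsGammaZero f) (hcont : FiniteContinuousOnRelInterior (mackeyTopology B) (conj B f))
    {x₀ : X} {a : ℝ} (hx₀ : f x₀ = a) : HasExactApproximations B f x₀ a := by
  obtain ⟨hL, y₁, hy₁, hc₁⟩ :=
    @FiniteContinuousOnRelInterior.exists_point Y _ _ (mackeyTopology B) _ hcont
  have hbot := conj_ne_bot (B := B) hf.dom_nonempty hf.ne_bot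
  intro U hU W hW v ρ hρ
  obtain ⟨V, hV, hVa, hVc, hVU⟩ := exists_absConvex_closed_nhds hU
  obtain ⟨W₁, hW₁, -, -, hWW⟩ := exists_absConvex_closed_nhds hW
  obtain ⟨W₂, hW₂, hW₂a, -, hWW₂⟩ := exists_absConvex_closed_nhds hW₁
  have h0V : (0 : X) ∈ V := mem_of_mem_nhds hV
  have h0W₂ : (0 : Y) ∈ W₂ := mem_of_mem_nhds hW₂
  have hW₂₁ : W₂ ⊆ W₁ := fun w hw => by simpa using hWW₂ w hw 0 h0W₂ 0 h0W₂
  have hK₀ : B.polar V ∈ weakDiscs B.flip := polar_mem_weakDiscs hB.flip hV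
  set K₀ := B.polar V with hK₀def
  have h0K₀ : (0 : Y) ∈ K₀ := B.zero_mem_polar V
  obtain ⟨r, hr, hrW⟩ := exists_smul_mem_of_weakly_compact hB.flip (weakDiscs.absConvex hK₀)
    hK₀.2.2 hW₁
  obtain ⟨c, hc, hcW⟩ := exists_pos_smul_mem hW₂ v
  let δ := min 1 (ρ / 4)
  have hδ : 0 < δ := by positivity
  have hδ1 : δ ≤ 1 := min_le_left _ _
  have hδρ : δ ≤ ρ / 4 := min_le_right _ _
  refine ⟨W₂, hW₂, min (min (r * δ) (c * δ)) (min δ (ρ / 4)), by positivity, ?_⟩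
  intro μ ε y hμ hε hη hyv hsub
  rw [lt_min_iff, lt_min_iff, lt_min_iff] at hη
  obtain ⟨⟨hηr, hηc⟩, hηδ, hηρ⟩ := hη
  have hconj : conj B f y ≤ ((B x₀ y - a + ε : ℝ) : EReal) := by
    rw [conj_le_iff hf.ne_bot]
    intro x s hs
    have := hsub x s hs
    rw [map_sub, LinearMap.sub_apply] at this
    linarith
  have hb : conj B f y = ((conj B f y).toReal : EReal) :=
    (EReal.coe_toReal (hconj.trans_lt (EReal.coe_lt_top _)).ne (hbot y)).symm
  set b := (conj B f y).toReal
  rw [hb, EReal.coe_le_coe_iff] at hconj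
  have hsub' : ∀ u (s : ℝ), conj B f u ≤ s → B.flip (u - y) x₀ ≤ s - b + ε := by
    intro u s hs
    have := (conj_le_iff hf.ne_bot u s).1 hs x₀ a hx₀.le
    rw [map_sub, LinearMap.sub_apply, LinearMap.flip_apply, LinearMap.flip_apply]
    linarith
  set d := y₁ - y with hd
  obtain ⟨s, hs, hsW⟩ := exists_pos_smul_mem hW₂ d
  -- This segment gives `|B κ (μ • y)| ≤ 1`, which controls `μ * B (x - x₀) y`. Its contribution to
  -- the displacement of `μ • y` is a small multiple of `μ • y`, itself close to `v`.
  have hK₁ := add_segment_mem_weakDiscs hK₀ (μ • y)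
  have hK₂ := add_segment_mem_weakDiscs hK₁ (s • d)
  obtain ⟨t, k, ht0, htε, hk, hN⟩ := @exists_subdiff_of_approx Y X _ _ _ _ B.flip
    (mackeyTopology B) _ (mackey_isTopologicalAddGroup B) (mackey_continuousSMul B)
    (mackey_locallyConvexSpace B) _ _ _ hB.mackey_flip _ hbot (convex_epi_conj hf.ne_bot)
    (lowerSemicontinuous_conj f) hL _ hy₁ hc₁ _ _ hb _ _ hε hsub' _ hδ _ hK₂ _ hs
    (mem_add_segment (subset_add_segment _ _ h0K₀) (s • d))
  have htδ : t * δ ≤ ε := by rwa [le_div_iff₀ hδ] at htε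
  have hμtδ : μ * t * δ ≤ μ * ε := by
    rw [mul_assoc]
    exact mul_le_mul_of_nonneg_left htδ hμ.le
  have hμt0 : 0 ≤ μ * t := by positivity
  have hμtr : μ * t ≤ r := le_of_mul_le_mul_right (hμtδ.trans hηr.le) hδ
  have hμtc : μ * t ≤ c := le_of_mul_le_mul_right (hμtδ.trans hηc.le) hδ
  have hμt1 : μ * t ≤ 1 := le_of_mul_le_mul_right (by linarith) hδ
  have hN0 : {n : X | n ∈ V ∧ |B n (μ • y)| < ρ / 4 ∧ |B n (μ • t • k)| < ρ / 4} ∈ 𝓝 (0 : X) := by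
    have h2 : ∀ z : Y, {n : X | |B n z| < ρ / 4} ∈ 𝓝 (0 : X) := fun z =>
      (hB.continuous_apply_left z).abs.continuousAt.eventually_lt_const (by simpa using hρ)
    exact inter_mem hV (inter_mem (h2 _) (h2 _))
  obtain ⟨g, κ, hg, hκ, hnV, hny, hnk⟩ := hN _ hN0
  have hκk : |B κ k| ≤ 1 := hκ k hk
  have hκy : |B κ (μ • y)| ≤ 1 :=
    hκ _ (subset_add_segment _ _ (mem_add_segment h0K₀ (μ • y)))
  have hκV : κ ∈ V := by
    refine bipolar_subset hB hVa hVc ⟨0, h0V⟩ fun z hz => ?_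
    exact hκ z (subset_add_segment _ _ (subset_add_segment _ _ hz))
  have hgx : g - x₀ = δ • κ + (g - x₀ - δ • κ) := by abel
  set n := g - x₀ - δ • κ
  refine ⟨g, y + t • k, mem_subdiff_of_mem_subdiff_conj hB hf hg, ?_, ?_, ?_, ?_⟩
  · rw [hgx, ← add_zero (δ • κ + n)]
    exact hVU _ (AbsConvex.smul_mem_of_abs_le hVa hκV (by rwa [abs_of_pos hδ])) _ hnV _ h0V
  · obtain ⟨_, ⟨k₀, hk₀, _, ⟨τ, hτ, rfl⟩, rfl⟩, _, ⟨τ', hτ', rfl⟩, rfl⟩ := hk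
    have hτ1 : |μ * t * τ| ≤ μ * t := by
      rw [abs_mul, abs_of_nonneg hμt0]
      exact mul_le_of_le_one_right hμt0 (abs_le.2 hτ)
    have hτ1' : |μ * t * τ'| ≤ 1 := by
      rw [abs_mul, abs_of_nonneg hμt0]
      exact mul_le_one₀ hμt1 (abs_nonneg _) (abs_le.2 hτ')
    have h1 : μ • (y + t • (k₀ + τ • μ • y + τ' • s • d)) - v = (μ • y - v) + (μ * t) • k₀ +
        ((μ * t * τ) • v + (μ * t * τ) • (μ • y - v) + (μ * t * τ' * s) • d) := by
      module
    dsimp only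
    rw [h1]
    refine hWW _ (hW₂₁ hyv) _ (hrW _ (by rwa [abs_of_nonneg hμt0]) _ hk₀) _
      (hWW₂ _ (hcW _ (hτ1.trans hμtc)) _
        (AbsConvex.smul_mem_of_abs_le hW₂a hyv (hτ1.trans hμt1)) _ (hsW _ ?_))
    rw [abs_mul, abs_of_pos hs]
    exact mul_le_of_le_one_left hs.le hτ1'
  · have h1 : μ * B (g - x₀) y = δ * B κ (μ • y) + B n (μ • y) := by
      rw [hgx]
      simp only [map_add, map_smul, LinearMap.add_apply, LinearMap.smul_apply, smul_eq_mul]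
      ring
    rw [h1]
    have h2 := abs_add_le (δ * B κ (μ • y)) (B n (μ • y))
    have h3 : |δ * B κ (μ • y)| ≤ δ := by
      rw [abs_mul, abs_of_pos hδ]
      exact mul_le_of_le_one_right hδ.le hκy
    linarith
  · have h1 : μ * B (g - x₀) (y + t • k - y) = μ * t * δ * B κ k + B n (μ • t • k) := by
      rw [hgx]
      simp only [add_sub_cancel_left, map_add, map_smul, LinearMap.add_apply,
        LinearMap.smul_apply, smul_eq_mul]
      ring
    rw [h1]
    have h2 := abs_add_le (μ * t * δ * B κ k) (B n (μ • t • k))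
    have h3 : |μ * t * δ * B κ k| ≤ μ * t * δ := by
      rw [abs_mul, abs_of_nonneg (by positivity)]
      exact mul_le_of_le_one_right (by positivity) hκk
    linarith

theorem normalCone_subset_upperLimit (hB : IsDualPair B) {f : X → EReal} (hf : IsGammaZero f)
    {x₀ : X} {a : ℝ} (hx₀ : f x₀ = a) (happ : HasExactApproximations B f x₀ a) (A : Set Y) :
    normalCone B (sublevel f (f x₀)) x₀ ⊆
      upperLimit (valueFilter B f x₀ ⊓ quotientFilter B A x₀) (scaledSubdiff B f) := by
  intro v hv W hW Z hZ
  obtain ⟨Z₁, hZ₁, Z₂, hZ₂, rfl⟩ := Filter.mem_inf_iff.1 hZ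
  obtain ⟨Z₃, hZ₃, Z₄, hZ₄, rfl⟩ := Filter.mem_inf_iff.1 hZ₁
  obtain ⟨Z₅, hZ₅, Z₆, hZ₆, rfl⟩ := Filter.mem_inf_iff.1 hZ₃
  obtain ⟨S₆, hS₆, hS₆Z⟩ := Filter.mem_comap.1 hZ₆
  obtain ⟨S₄, hS₄, hS₄Z⟩ := Filter.mem_comap.1 hZ₄
  obtain ⟨S₂, hS₂, hS₂Z⟩ := Filter.mem_comap.1 hZ₂
  obtain ⟨ρ, hρ, hρS⟩ := Metric.mem_nhds_iff.1 (inter_mem hS₆ hS₄)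
  have hU : {x : X | (Submodule.Quotient.mk (x₀ + x) : X ⧸ orth B A) ∈ S₂} ∈ 𝓝 (0 : X) := by
    have : ContinuousAt (fun x : X => (Submodule.Quotient.mk (x₀ + x) : X ⧸ orth B A)) 0 := by
      have h1 : Continuous (Submodule.Quotient.mk : X → X ⧸ orth B A) := continuous_quot_mk
      exact (h1.comp (by fun_prop : Continuous fun x : X => x₀ + x)).continuousAt
    exact this.preimage_mem_nhds (by simpa using hS₂)
  have hW₀ : {w : Y | v + w ∈ W} ∈ 𝓝 (0 : Y) := by
    have : ContinuousAt (fun w : Y => v + w) 0 := by fun_prop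
    exact this.preimage_mem_nhds (by simpa using hW)
  -- The tolerances `W'` and `η` are fixed before `μ` and `y` are chosen. Two errors of `ρ / 3`
  -- bound `μ * B (x - x₀) y'`, and the exact and approximate subgradient inequalities enclose the
  -- value term.
  obtain ⟨W', hW', η, hη, hmain⟩ := happ _ hU _ hW₀ v (ρ / 3) (by positivity)
  obtain ⟨μ, y, ε, hμ, hε, hμε, hyv, hsub⟩ := exists_approx_of_mem_normalCone hB hf hx₀ hv hW'
    (η := min η (ρ / 3)) (by positivity)
  rw [lt_min_iff] at hμε
  obtain ⟨x, y', hy', hxU, hyW, h1, h2⟩ := hmain μ ε y hμ hε hμε.1 hyv hsub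
  have hx : f x = ((f x).toReal : EReal) := (EReal.coe_toReal hy'.1.ne (hf.ne_bot x)).symm
  have h3 : |μ * B (x - x₀) y'| < ρ := by
    have h4 : μ * B (x - x₀) y' = μ * B (x - x₀) y + μ * B (x - x₀) (y' - y) := by
      rw [map_sub (B _)]; ring
    rw [h4]
    have := abs_add_le (μ * B (x - x₀) y) (μ * B (x - x₀) (y' - y))
    linarith
  have h5 : |μ * ((f x).toReal - (f x₀).toReal)| < ρ := by
    have h6 := mul_le_mul_of_nonneg_left
      ((mem_subdiff_iff hf.ne_bot hx y').1 hy' x₀ a hx₀.le) hμ.le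
    have h7 := mul_le_mul_of_nonneg_left (hsub x _ hx.le) hμ.le
    have h8 : μ * B (x₀ - x) y' = -(μ * B (x - x₀) y') := by
      rw [← neg_sub, map_neg, LinearMap.neg_apply]; ring
    rw [h8] at h6
    rw [hx₀, EReal.toReal_coe]
    rw [abs_lt] at h1 h2 h3 ⊢
    constructor <;> linarith
  refine ⟨(x, μ, y'), ⟨⟨⟨hZ₅ hμ.le, hS₆Z ?_⟩, hS₄Z ?_⟩, hS₂Z ?_⟩, μ • y', ⟨hy', rfl⟩, ?_⟩
  · exact (hρS (by simpa using h5)).1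
  · exact (hρS (by simpa using h3)).2
  · simpa using hxU
  · simpa using hyW

end Final

end ConvexDual

end


open ConvexDual
theorem theorem4p4 {X Y : Type*}
    [AddCommGroup X] [Module ℝ X] [tX : TopologicalSpace X] [IsTopologicalAddGroup X]
    [ContinuousSMul ℝ X] [LocallyConvexSpace ℝ X]
    [AddCommGroup Y] [Module ℝ Y] [TopologicalSpace Y] [IsTopologicalAddGroup Y]
    [ContinuousSMul ℝ Y] [LocallyConvexSpace ℝ Y]
    (B : X →ₗ[ℝ] Y →ₗ[ℝ] ℝ) (hB : IsDualPair B)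
    (Φ : X → EReal) (hΦ : IsGammaZero Φ)
    (h : FiniteContinuousOnRelInterior tX Φ ∨
      FiniteContinuousOnRelInterior (mackeyTopology B) (conj B Φ))
    (x₀ : X) (hx₀ : x₀ ∈ dom Φ) :
    normalCone B (sublevel Φ (Φ x₀)) x₀ =
        upperLimit (valueFilter B Φ x₀ ⊓ quotientFilter B (dom (conj B Φ)) x₀)
          (scaledSubdiff B Φ) ∧
      upperLimit (valueFilter B Φ x₀ ⊓ quotientFilter B (dom (conj B Φ)) x₀)
          (scaledSubdiff B Φ) =
        upperLimit (valueFilter B Φ x₀) (scaledSubdiff B Φ) := by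
  have ha : Φ x₀ = ((Φ x₀).toReal : EReal) := (EReal.coe_toReal hx₀.ne (hΦ.ne_bot x₀)).symm
  have happ : HasExactApproximations B Φ x₀ (Φ x₀).toReal := by
    rcases h with h | h
    · exact hasExactApproximations_of_continuous hB hΦ h ha
    · exact hasExactApproximations_of_continuous_conj hB hΦ h ha
  have h1 := normalCone_subset_upperLimit hB hΦ ha happ (dom (conj B Φ))
  have h2 : upperLimit (valueFilter B Φ x₀ ⊓ quotientFilter B (dom (conj B Φ)) x₀)
      (scaledSubdiff B Φ) ⊆ upperLimit (valueFilter B Φ x₀) (scaledSubdiff B Φ) :=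
    upperLimit_mono inf_le_left _
  have h3 := upperLimit_subset_normalCone hB hΦ.ne_bot ha
  exact ⟨h1.antisymm (h2.trans h3), h2.antisymm (h3.trans h1)⟩
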